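/- Let $k$ be an algebraically closed field of characteristic zero, let $n\ge 0$, let $G=PGL_2$ act diagonally on $X=(\mathbb{P}^1)^n$ over $k$, and let $\mathfrak{g}=\mathfrak{sl}_2$ be its Lie algebra, with the usual basis $E=\begin{pmatrix}0&1\\0&0\end{pmatrix}$, $H=\begin{pmatrix}1&0\\0&-1\end{pmatrix}$, $F=\begin{pmatrix}0&0\\1&0\end{pmatrix}$. Let $X_0,Y_0,Z_0$ be the homogeneous coordinates on the space of lines $\mathbb{P}(\mathfrak{g})\cong\mathbb{P}^2$ that are dual to the basis $-E,H,F$. The infinitesimal action $\mathfrak{g}\to H^0(X,T_X)$, dual to $\Omega_X\to\mathfrak{g}^\vee\otimes\mathcal{O}_X$, defines a section $s\in H^0(X\times\mathbb{P}(\mathfrak{g}),\,T_X\boxtimes\mathcal{O}_{\mathbb{P}(\mathfrak{g})}(1))$. Let $M\subset X\times\mathbb{P}(\mathfrak{g})$ be the scheme-theoretic zero locus of $s$. Then, with $(x_i:y_i)$ the homogeneous coordinates on the $i$-th factor $\mathbb{P}^1$ and $s_i=x_i^2Z_0-2x_iy_iY_0+y_i^2X_0$, we have $M=\bigcap_{i=1}^n(s_i=0)$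 as closed subschemes, and $M$ is a local complete intersection of codimension $n$: near each of its points the ideal of $M$ is generated by $n$ functions that form a regular sequence in the local ring of $X\times\mathbb{P}(\mathfrak{g})$ at that point. Moreover, the $n$ components of $s$ in the standard local frames of $T_X\boxtimes\mathcal{O}(1)$ (given by the vector fields $\partial/\partial(x_i/y_i)$ or $\partial/\partial(y_i/x_i)$ and by a homogeneous coordinate on $\mathbb{P}(\mathfrak{g})$) form such a regular sequence at every point of $M$. In particular, $\dim M=2$. -/

import Mathlib

open CategoryTheory CategoryTheory.Limits AlgebraicGeometry

universe u

namespace DiagonalAction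

noncomputable section

/-! ### Projective spaces over a field -/

/-- The grading by degree on `k[X₀, …, X_{m-1}]`. -/
abbrev grading (k : Type u) [Field k] (m : ℕ) : ℕ → Submodule k (MvPolynomial (Fin m) k) :=
  MvPolynomial.homogeneousSubmodule (Fin m) k

instance gradedRingGrading (k : Type u) [Field k] (m : ℕ) : GradedAlgebra (grading k m) :=
  MvPolynomial.gradedAlgebra

/-- The projective space `Proj k[X₀, …, X_{m-1}]`, of dimension `m - 1`. -/
abbrev projSpace (k : Type u) [Field k] (m : ℕ) : Scheme.{u} :=
  Proj (grading k m)

/-- The structure morphism of projective space. -/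
def projStr (k : Type u) [Field k] (m : ℕ) : projSpace k m ⟶ Spec (.of k) :=
  Proj.toSpecZero (grading k m) ≫
    Spec.map (CommRingCat.ofHom (algebraMap k (grading k m 0)))

/-- The ring of regular functions on the standard affine chart `D₊(X a)`. -/
abbrev ChartRing (k : Type u) [Field k] (m : ℕ) (a : Fin m) : Type u :=
  HomogeneousLocalization.Away (grading k m) (MvPolynomial.X a)

/-- The standard affine chart `D₊(X a)`. -/
abbrev chart (k : Type u) [Field k] (m : ℕ) (a : Fin m) : (projSpace k m).Opens :=
  Proj.basicOpen (grading k m) (MvPolynomial.X a)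

theorem X_mem_grading (k : Type u) [Field k] {m : ℕ} (a : Fin m) :
    MvPolynomial.X a ∈ grading k m 1 :=
  MvPolynomial.isHomogeneous_X k a

theorem X_mem_grading_smul (k : Type u) [Field k] {m : ℕ} (a : Fin m) :
    MvPolynomial.X a ∈ grading k m (1 • 1) :=
  MvPolynomial.isHomogeneous_X k a

/-- The function `X b / X a` on the chart `D₊(X a)`. -/
def coord (k : Type u) [Field k] {m : ℕ} (a b : Fin m) : ChartRing k m a :=
  HomogeneousLocalization.Away.mk (grading k m) (X_mem_grading k a) 1
    (MvPolynomial.X b) (X_mem_grading_smul k b)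

/-! ### The Lie algebra `𝔰𝔩₂` and its action on `ℙ¹` by vector fields -/

attribute [local instance 100] LieRing.ofAssociativeRing

/-- The Lie algebra `𝔰𝔩₂` of `PGL₂` (in characteristic zero). -/
abbrev sl2 (k : Type u) [Field k] : LieSubalgebra k (Matrix (Fin 2) (Fin 2) k) :=
  LieAlgebra.SpecialLinear.sl (Fin 2) k

/-- The coordinates `X₀, Y₀, Z₀` on `𝔰𝔩₂`: the matrix `-X₀ E + Y₀ H + Z₀ F` has entries
`(Y₀, -X₀; Z₀, -Y₀)`. -/
def sl2Equiv (k : Type u) [Field k] : sl2 k ≃ₗ[k] (Fin 3 → k) where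
  toFun A := ![-A.1 0 1, A.1 0 0, A.1 1 0]
  invFun c := ⟨!![c 1, -c 0; c 2, -c 1], by
    change !![c 1, -c 0; c 2, -c 1] ∈ LinearMap.ker (Matrix.traceLinearMap (Fin 2) k k)
    simp [Matrix.trace_fin_two]⟩
  map_add' A B := by
    ext i; fin_cases i <;> simp [add_comm]
  map_smul' c A := by
    ext i; fin_cases i <;> simp
  left_inv A := by
    have h : A.1.trace = 0 := A.2
    rw [Matrix.trace_fin_two] at h
    apply Subtype.ext
    ext i j
    fin_cases i <;> fin_cases j <;> simp
    linear_combination -h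
  right_inv c := by
    ext i; fin_cases i <;> simp

/-- The basis `(-E, H, F)` of `𝔰𝔩₂`, where `E = (0, 1; 0, 0)`, `H = (1, 0; 0, -1)`,
`F = (0, 0; 1, 0)`. The homogeneous coordinates `X₀, Y₀, Z₀` of `ℙ(𝔰𝔩₂)` are the dual basis. -/
def sl2Basis (k : Type u) [Field k] : Module.Basis (Fin 3) k (sl2 k) :=
  Module.Basis.ofEquivFun (sl2Equiv k)

theorem sl2Basis_zero (k : Type u) [Field k] : (sl2Basis k 0).1 = !![0, -1; 0, 0] := by
  simp [sl2Basis, sl2Equiv]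

theorem sl2Basis_one (k : Type u) [Field k] : (sl2Basis k 1).1 = !![1, 0; 0, -1] := by
  simp [sl2Basis, sl2Equiv]

theorem sl2Basis_two (k : Type u) [Field k] : (sl2Basis k 2).1 = !![0, 0; 1, 0] := by
  simp [sl2Basis, sl2Equiv]

/-- The infinitesimal action of a matrix `A` on polynomials in the homogeneous coordinates
`v = (x, y)`: the derivation sending the vector of coordinates `v` to `A v`. -/
def polyDer {k : Type u} [Field k] (A : Matrix (Fin 2) (Fin 2) k) :
    Derivation k (MvPolynomial (Fin 2) k) (MvPolynomial (Fin 2) k) :=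
  MvPolynomial.mkDerivation k fun i => ∑ j, MvPolynomial.C (A i j) * MvPolynomial.X j

/-- `polyDer A` is the derivative of the action of the group: `f ((1 + ε A) v) = f + ε (polyDer A f)`
over the dual numbers. -/
theorem aeval_one_add_eps {k : Type u} [Field k] (A : Matrix (Fin 2) (Fin 2) k)
    (f : MvPolynomial (Fin 2) k) :
    MvPolynomial.aeval (fun i : Fin 2 =>
        (TrivSqZeroExt.inl (MvPolynomial.X i) +
          TrivSqZeroExt.inr (∑ j, MvPolynomial.C (A i j) * MvPolynomial.X j) :
          DualNumber (MvPolynomial (Fin 2) k))) f =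
      TrivSqZeroExt.inl f + TrivSqZeroExt.inr (polyDer A f) := by
  induction f using MvPolynomial.induction_on with
  | C c =>
    rw [MvPolynomial.aeval_C, ← MvPolynomial.algebraMap_eq, Derivation.map_algebraMap,
      TrivSqZeroExt.inr_zero, add_zero]
    rfl
  | add p q hp hq =>
    rw [map_add, hp, hq, map_add, TrivSqZeroExt.inl_add, TrivSqZeroExt.inr_add]
    abel
  | mul_X p i hp =>
    rw [map_mul, hp, MvPolynomial.aeval_X, Derivation.leibniz]
    rw [show polyDer A (MvPolynomial.X i) = ∑ j, MvPolynomial.C (A i j) * MvPolynomial.X j from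
      MvPolynomial.mkDerivation_X k _ i]
    refine TrivSqZeroExt.ext ?_ ?_
    · simp
    · simp only [TrivSqZeroExt.snd_mul, TrivSqZeroExt.fst_add, TrivSqZeroExt.fst_inl,
        TrivSqZeroExt.fst_inr, TrivSqZeroExt.snd_add, TrivSqZeroExt.snd_inl,
        TrivSqZeroExt.snd_inr, add_zero, zero_add, MulOpposite.smul_eq_mul_unop,
        MulOpposite.unop_op, smul_eq_mul]
      ring

theorem polyDer_eq {k : Type u} [Field k] (A : Matrix (Fin 2) (Fin 2) k)
    (f : MvPolynomial (Fin 2) k) :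
    polyDer A f = ∑ i, (∑ j, MvPolynomial.C (A i j) * MvPolynomial.X j) *
      MvPolynomial.pderiv i f := by
  have h : polyDer A = ∑ i, (∑ j, MvPolynomial.C (A i j) * MvPolynomial.X j :
      MvPolynomial (Fin 2) k) • MvPolynomial.pderiv i := by
    refine MvPolynomial.derivation_ext fun i => ?_
    rw [polyDer, MvPolynomial.mkDerivation_X]
    fin_cases i <;> simp [MvPolynomial.pderiv_X]
  rw [h]
  simp

/-- The infinitesimal action preserves the degree. -/
theorem polyDer_mem {k : Type u} [Field k] (A : Matrix (Fin 2) (Fin 2) k) {d : ℕ}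
    {f : MvPolynomial (Fin 2) k} (hf : f ∈ grading k 2 d) : polyDer A f ∈ grading k 2 d := by
  have hl : ∀ i, (∑ j, MvPolynomial.C (A i j) * MvPolynomial.X j :
      MvPolynomial (Fin 2) k).IsHomogeneous 1 := fun i =>
    MvPolynomial.IsHomogeneous.sum _ _ _ fun j _ => MvPolynomial.isHomogeneous_C_mul_X _ _
  rcases Nat.eq_zero_or_pos d with rfl | hd
  · have h0 : f = MvPolynomial.C (f.coeff 0) := by
      rw [← MvPolynomial.totalDegree_eq_zero_iff_eq_C]
      exact Nat.le_zero.mp (MvPolynomial.IsHomogeneous.totalDegree_le hf)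
    rw [h0, ← MvPolynomial.algebraMap_eq, Derivation.map_algebraMap]
    exact zero_mem _
  · rw [polyDer_eq]
    refine sum_mem fun i _ => ?_
    have h := (hl i).mul (MvPolynomial.IsHomogeneous.pderiv (i := i) hf)
    rwa [Nat.add_sub_cancel' hd] at h

/-- The quotient rule on fractions: `p / q ↦ (A p · q - p · A q) / q²`. -/
def quotientRule {k : Type u} [Field k] (A : Matrix (Fin 2) (Fin 2) k)
    {S : Submonoid (MvPolynomial (Fin 2) k)}
    (c : HomogeneousLocalization.NumDenSameDeg (grading k 2) S) :
    HomogeneousLocalization.NumDenSameDeg (grading k 2) S where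
  deg := c.deg + c.deg
  num := ⟨polyDer A c.num.1 * c.den.1 - c.num.1 * polyDer A c.den.1,
    sub_mem (SetLike.mul_mem_graded (polyDer_mem A c.num.2) c.den.2)
      (SetLike.mul_mem_graded c.num.2 (polyDer_mem A c.den.2))⟩
  den := ⟨c.den.1 * c.den.1, SetLike.mul_mem_graded c.den.2 c.den.2⟩
  den_mem := mul_mem c.den_mem c.den_mem

/-- The quotient rule on homogeneous fractions of degree zero. -/
def quotientFun {k : Type u} [Field k] (A : Matrix (Fin 2) (Fin 2) k)
    {S : Submonoid (MvPolynomial (Fin 2) k)} :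
    HomogeneousLocalization (grading k 2) S → HomogeneousLocalization (grading k 2) S :=
  Quotient.map' (quotientRule A) (by
    rintro c d (h : Localization.mk _ _ = Localization.mk _ _)
    change Localization.mk _ _ = Localization.mk _ _
    rw [Localization.mk_eq_mk_iff, Localization.r_iff_exists] at h ⊢
    obtain ⟨e, he⟩ := h
    refine ⟨e * e, ?_⟩
    simp only [quotientRule, Submonoid.coe_mul] at he ⊢
    have h2 := congrArg (polyDer A) he
    simp only [Derivation.leibniz, smul_eq_mul] at h2
    set δ := polyDer A
    linear_combination (c.den.1 * d.den.1 * e.1) * h2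
      - (e.1 * (c.den.1 * δ d.den.1 + d.den.1 * δ c.den.1)
        + c.den.1 * d.den.1 * δ e.1) * he)

theorem quotientFun_mk {k : Type u} [Field k] (A : Matrix (Fin 2) (Fin 2) k)
    {S : Submonoid (MvPolynomial (Fin 2) k)}
    (c : HomogeneousLocalization.NumDenSameDeg (grading k 2) S) :
    quotientFun A (HomogeneousLocalization.mk c) =
      HomogeneousLocalization.mk (quotientRule A c) := rfl

theorem quotientFun_add {k : Type u} [Field k] (A : Matrix (Fin 2) (Fin 2) k)
    {S : Submonoid (MvPolynomial (Fin 2) k)} (x y : HomogeneousLocalization (grading k 2) S) :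
    quotientFun A (x + y) = quotientFun A x + quotientFun A y := by
  obtain ⟨c, rfl⟩ := HomogeneousLocalization.mk_surjective x
  obtain ⟨d, rfl⟩ := HomogeneousLocalization.mk_surjective y
  rw [← HomogeneousLocalization.mk_add, quotientFun_mk, quotientFun_mk, quotientFun_mk,
    ← HomogeneousLocalization.mk_add]
  apply HomogeneousLocalization.val_injective
  rw [HomogeneousLocalization.val_mk, HomogeneousLocalization.val_mk, Localization.mk_eq_mk_iff,
    Localization.r_iff_exists]
  refine ⟨1, ?_⟩
  simp only [quotientRule, HomogeneousLocalization.NumDenSameDeg.num_add,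
    HomogeneousLocalization.NumDenSameDeg.den_add, map_add, Derivation.leibniz, smul_eq_mul]
  ring

theorem quotientFun_mul {k : Type u} [Field k] (A : Matrix (Fin 2) (Fin 2) k)
    {S : Submonoid (MvPolynomial (Fin 2) k)} (x y : HomogeneousLocalization (grading k 2) S) :
    quotientFun A (x * y) = x * quotientFun A y + y * quotientFun A x := by
  obtain ⟨c, rfl⟩ := HomogeneousLocalization.mk_surjective x
  obtain ⟨d, rfl⟩ := HomogeneousLocalization.mk_surjective y
  rw [← HomogeneousLocalization.mk_mul, quotientFun_mk, quotientFun_mk, quotientFun_mk,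
    ← HomogeneousLocalization.mk_mul, ← HomogeneousLocalization.mk_mul,
    ← HomogeneousLocalization.mk_add]
  apply HomogeneousLocalization.val_injective
  rw [HomogeneousLocalization.val_mk, HomogeneousLocalization.val_mk, Localization.mk_eq_mk_iff,
    Localization.r_iff_exists]
  refine ⟨1, ?_⟩
  simp only [quotientRule, HomogeneousLocalization.NumDenSameDeg.num_add,
    HomogeneousLocalization.NumDenSameDeg.den_add, HomogeneousLocalization.NumDenSameDeg.num_mul,
    HomogeneousLocalization.NumDenSameDeg.den_mul, Derivation.leibniz, smul_eq_mul]
  ring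

/-- The vector field on the chart `D₊(X a)` of `ℙ¹` given by the infinitesimal action of `A`:
the derivation of the ring of regular functions given by the quotient rule. -/
def vectorField {k : Type u} [Field k] (A : Matrix (Fin 2) (Fin 2) k) (a : Fin 2) :
    Derivation ℤ (ChartRing k 2 a) (ChartRing k 2 a) :=
  Derivation.mk' (AddMonoidHom.toIntLinearMap (AddMonoidHom.mk' (quotientFun A)
    (quotientFun_add A))) (quotientFun_mul A)

theorem vectorField_mk {k : Type u} [Field k] (A : Matrix (Fin 2) (Fin 2) k) (a : Fin 2)
    (c : HomogeneousLocalization.NumDenSameDeg (grading k 2)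
      (Submonoid.powers (MvPolynomial.X a))) :
    vectorField A a (HomogeneousLocalization.mk c) =
      HomogeneousLocalization.mk (quotientRule A c) := rfl

/-! ### The section `s` on `(ℙ¹)ⁿ × ℙ(𝔰𝔩₂)` -/

/-- The scheme `X = (ℙ¹)ⁿ`, the fibre product over `k` of `n` copies of `ℙ¹`. -/
abbrev powP1 (k : Type u) [Field k] (n : ℕ) : Scheme.{u} :=
  widePullback (Spec (.of k)) (fun _ : Fin n => projSpace k 2) (fun _ => projStr k 2)

/-- The scheme `W = X × ℙ(𝔰𝔩₂)`, where `ℙ(𝔰𝔩₂) = Proj k[X₀, Y₀, Z₀]`. -/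
abbrev ambient (k : Type u) [Field k] (n : ℕ) : Scheme.{u} :=
  pullback (WidePullback.base (fun _ : Fin n => projStr k 2)) (projStr k 3)

/-- The projection of `W` to the `i`-th factor `ℙ¹`. -/
def prP1 (k : Type u) [Field k] {n : ℕ} (i : Fin n) : ambient k n ⟶ projSpace k 2 :=
  pullback.fst _ _ ≫ WidePullback.π (fun _ : Fin n => projStr k 2) i

/-- The projection of `W` to `ℙ(𝔰𝔩₂)`. -/
def prLie (k : Type u) [Field k] (n : ℕ) : ambient k n ⟶ projSpace k 3 :=
  pullback.snd _ _

/-- The open subscheme of `W` where the `a`-th coordinate of the `i`-th factor `ℙ¹` and the `j`-th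
coordinate of `ℙ(𝔰𝔩₂)` do not vanish. -/
def opens (k : Type u) [Field k] {n : ℕ} (i : Fin n) (a : Fin 2) (j : Fin 3) :
    (ambient k n).Opens :=
  prP1 k i ⁻¹ᵁ chart k 2 a ⊓ prLie k n ⁻¹ᵁ chart k 3 j

/-- Pullback of functions on the chart `D₊(X a)` of the `i`-th factor `ℙ¹`. -/
def pullP1 (k : Type u) [Field k] {n : ℕ} (i : Fin n) (a : Fin 2) (j : Fin 3) :
    ChartRing k 2 a →+* Γ(ambient k n, opens k i a j) :=
  (Proj.awayToSection (grading k 2) (MvPolynomial.X a) ≫ (prP1 k i).app (chart k 2 a) ≫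
    (ambient k n).presheaf.map (homOfLE inf_le_left).op).hom

/-- Pullback of functions on the chart `D₊(X j)` of `ℙ(𝔰𝔩₂)`. -/
def pullLie (k : Type u) [Field k] {n : ℕ} (i : Fin n) (a : Fin 2) (j : Fin 3) :
    ChartRing k 3 j →+* Γ(ambient k n, opens k i a j) :=
  (Proj.awayToSection (grading k 3) (MvPolynomial.X j) ≫ (prLie k n).app (chart k 3 j) ≫
    (ambient k n).presheaf.map (homOfLE inf_le_right).op).hom

/-- The value `s(df)` of the section `s` of `T_X ⊠ 𝒪(1)`, seen as a map `Ω_X ⊠ 𝒪(-1) → 𝒪_W`, on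
the differential of a function `f` on the chart `D₊(X a)` of the `i`-th factor `ℙ¹` (over the chart
`D₊(X j)` of `ℙ(𝔰𝔩₂)`, where the `j`-th homogeneous coordinate trivializes `𝒪(1)`):
the function `f` is derived along the vector field of the tautological element
`∑ b, (X b / X j) • sl2Basis b` of the Lie algebra. Since the action is diagonal, `T_X` is the direct
sum of the pullbacks of the tangent bundles of the factors, and `s` acts on each of them in this
way. -/
def sectionVal (k : Type u) [Field k] {n : ℕ} (i : Fin n) (a : Fin 2) (j : Fin 3)
    (f : ChartRing k 2 a) : Γ(ambient k n, opens k i a j) :=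
  ∑ b : Fin 3, pullLie k i a j (coord k j b) *
    pullP1 k i a j (vectorField (sl2Basis k b).1 a f)

/-- The `i`-th component of `s` in the frame of `T_X ⊠ 𝒪(1)` given by the vector fields `∂/∂t`,
where `t = X (1 - a) / X a` is the affine coordinate of the chart `D₊(X a)` of the `i`-th factor. -/
def sectionComponent (k : Type u) [Field k] {n : ℕ} (i : Fin n) (a : Fin 2) (j : Fin 3) :
    Γ(ambient k n, opens k i a j) :=
  sectionVal k i a j (coord k a a.rev)

/-- The form `s_i = x_i² Z₀ - 2 x_i y_i Y₀ + y_i² X₀`, divided by the `j`-th coordinate of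
`ℙ(𝔰𝔩₂)` and the square of the `a`-th coordinate of the `i`-th factor. -/
def formVal (k : Type u) [Field k] {n : ℕ} (i : Fin n) (a : Fin 2) (j : Fin 3) :
    Γ(ambient k n, opens k i a j) :=
  pullP1 k i a j (coord k a 0) ^ 2 * pullLie k i a j (coord k j 2)
    - 2 * pullP1 k i a j (coord k a 0) * pullP1 k i a j (coord k a 1) *
        pullLie k i a j (coord k j 1)
    + pullP1 k i a j (coord k a 1) ^ 2 * pullLie k i a j (coord k j 0)

/-! ### Zero loci and local complete intersections -/

/-- The function `g` on the open set `V` is a section of the ideal sheaf `J`, that is, it vanishes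
on the closed subscheme of `J`. -/
def VanishesOn {W : Scheme.{u}} (J : W.IdealSheafData) {V : W.Opens} (g : Γ(W, V)) : Prop :=
  ∀ (U : W.affineOpens) (hU : U.1 ≤ V), W.presheaf.map (homOfLE hU).op g ∈ J.ideal U

/-- The ideal sheaf of the scheme-theoretic zero locus `M` of `s`: the smallest ideal sheaf that
contains the image of `Ω_X ⊠ 𝒪(-1) → 𝒪_W`. -/
def zeroLocus (k : Type u) [Field k] (n : ℕ) : (ambient k n).IdealSheafData :=
  sInf {J | ∀ (i : Fin n) (a : Fin 2) (j : Fin 3) (f : ChartRing k 2 a),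
    VanishesOn J (sectionVal k i a j f)}

/-- The ideal sheaf of the divisor `s_i = 0`, the smallest ideal sheaf that contains the
dehomogenized forms. -/
def formLocus (k : Type u) [Field k] {n : ℕ} (i : Fin n) : (ambient k n).IdealSheafData :=
  sInf {J | ∀ (a : Fin 2) (j : Fin 3), VanishesOn J (formVal k i a j)}

/-- The closed subscheme of `W` with ideal sheaf `J` is a local complete intersection of codimension
`r`: near each of its points, its ideal is generated by `r` functions which form a regular sequence
in the local ring of `W`. -/
def IsLocalCompleteIntersection {W : Scheme.{u}} (J : W.IdealSheafData) (r : ℕ) : Prop :=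
  ∀ w ∈ J.support, ∃ (U : W.affineOpens) (hw : w ∈ U.1) (g : Fin r → Γ(W, U.1)),
    J.ideal U = Ideal.span (Set.range g) ∧
    RingTheory.Sequence.IsRegular (W.presheaf.stalk w)
      (List.ofFn fun i => W.presheaf.germ U.1 w hw (g i))

end

end DiagonalAction

/-! The point is that the components of `s` are polynomials in separate variables. On the chart
where chosen homogeneous coordinates of all factors are nonzero, the ambient scheme is the spectrum
of `A[t₁, …, tₙ]`, with `A` the ring of a chart of `ℙ(𝔰𝔩₂)` (`stdEquiv`). The `i`-th component of
`s` is, up to sign, the dehomogenization of `s_i`. It is a quadratic polynomial in `tᵢ` alone, with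
coefficients in `A` (`stdEval_componentPoly`). Up to sign these coefficients are the dehomogenized
`X₀`, `2Y₀`, `Z₀`. Since one of the coordinates is `1` and `2` is invertible, they generate the unit
ideal (`coeff_componentPoly_generate`).

By McCoy's theorem such a polynomial is a nonzerodivisor modulo every ideal generated by polynomials
in the other variables, so the components are weakly regular (`isWeaklyRegular_ofFn_aeval_X`).
Localizing at a point of `M`, where all components vanish, gives a regular sequence in the stalk.

Equality of the closed subschemes is a statement about generators: `s(df)` is a multiple of `s(dt)`,
which is `s_i` up to sign (`zeroLocus_eq`). To read off ideals on charts, `formLocus_spec`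
identifies the smallest ideal sheaf containing the forms with one glued from principal ideals.

For the dimension, the charts have dimension at most `n + 2` and each term of a weakly regular
sequence lowers it by at least one, which bounds `dim M` by `2`. Conversely, one chart of `M`
contains an affine plane: vector fields with a chosen zero, the zero being repeated in all factors.
-/

namespace DiagonalAction

/-! ### Weakly regular sequences of polynomials in separate variables, and Krull dimension. -/

section RegularSequence

/-- McCoy: a polynomial whose coefficients generate the unit ideal is a nonzerodivisor modulo
every ideal extended from the coefficients. -/
theorem mem_map_C_of_mul_mem {S : Type*} [CommRing S] {p : Polynomial S}
    (hp : ∀ I : Ideal S, (∀ m, p.coeff m ∈ I) → I = ⊤) (I : Ideal S) {q : Polynomial S}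
    (h : p * q ∈ I.map Polynomial.C) : q ∈ I.map Polynomial.C := by
  have hmem : ∀ r : Polynomial S,
      r ∈ I.map Polynomial.C ↔ r.map (Ideal.Quotient.mk I) = 0 := fun r => by
    simp [Ideal.mem_map_C_iff, Polynomial.ext_iff, Ideal.Quotient.eq_zero_iff_mem]
  rw [hmem, Polynomial.map_mul] at h
  rw [hmem]
  have hnzd : p.map (Ideal.Quotient.mk I) ∈ nonZeroDivisors (Polynomial (S ⧸ I)) := by
    rw [Polynomial.mem_nonZeroDivisors_iff]
    intro a ha
    -- McCoy leaves only constants `a` that kill `p` modulo `I`. All coefficients of `p` then lie in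
    -- the annihilator of `a`, so it is the unit ideal and `a = 0`.
    have h1 := hp ((Ideal.span {a}).annihilator.comap (Ideal.Quotient.mk I)) fun m => by
      rw [Ideal.mem_comap, Submodule.mem_annihilator_span_singleton, smul_eq_mul, mul_comm]
      simpa using congrArg (fun r => r.coeff m) ha
    have h2 : (1 : S) ∈ (Ideal.span {a}).annihilator.comap (Ideal.Quotient.mk I) := h1 ▸ trivial
    rw [Ideal.mem_comap, Submodule.mem_annihilator_span_singleton] at h2
    simpa using h2
  exact (mem_nonZeroDivisors_iff.mp hnzd).1 _ h

/-- Membership in ideals of the ring replaces the quotient modules by `I • ⊤`. Both McCoy's argument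
and the dimension count are phrased in this form. -/
theorem isWeaklyRegular_iff_forall_mem {S : Type*} [CommRing S] (rs : List S) :
    RingTheory.Sequence.IsWeaklyRegular S rs ↔ ∀ (i : ℕ) (h : i < rs.length) (x : S),
      rs[i] * x ∈ Ideal.ofList (rs.take i) → x ∈ Ideal.ofList (rs.take i) := by
  rw [RingTheory.Sequence.isWeaklyRegular_iff]
  refine forall₂_congr fun i hi => ?_
  rw [isSMulRegular_iff_right_eq_zero_of_smul, (Submodule.Quotient.mk_surjective _).forall]
  refine forall_congr' fun x => ?_
  rw [← Submodule.Quotient.mk_smul, Submodule.Quotient.mk_eq_zero, Submodule.Quotient.mk_eq_zero]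
  simp

/-- Polynomials in separate variables, each with coefficients generating the unit ideal, form a
weakly regular sequence. -/
theorem isWeaklyRegular_ofFn_aeval_X {R : Type*} [CommRing R] {n : ℕ} (p : Fin n → Polynomial R)
    (hp : ∀ i, ∀ I : Ideal R, (∀ m, (p i).coeff m ∈ I) → I = ⊤) :
    RingTheory.Sequence.IsWeaklyRegular (MvPolynomial (Fin n) R)
      (List.ofFn fun i => Polynomial.aeval (MvPolynomial.X i : MvPolynomial (Fin n) R) (p i)) := by
  classical
  rw [isWeaklyRegular_iff_forall_mem]
  intro i hi x hx
  have hin : i < n := by simpa using hi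
  rw [List.getElem_ofFn] at hx
  generalize hI : Ideal.ofList ((List.ofFn fun i => Polynomial.aeval
    (MvPolynomial.X i : MvPolynomial (Fin n) R) (p i)).take i) = I at hx ⊢
  -- `φ` renames the `i`-th variable to a new variable `T` and treats the others as constants; `ψ`
  -- sets `T` back to that variable. Keeping the whole polynomial ring as coefficient ring avoids
  -- splitting the set of variables.
  obtain ⟨φ, hφ⟩ : ∃ φ : MvPolynomial (Fin n) R →ₐ[R] Polynomial (MvPolynomial (Fin n) R),
      ∀ j, φ (MvPolynomial.X j) = if j = ⟨i, hin⟩ then Polynomial.X else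
        Polynomial.C (MvPolynomial.X j) :=
    ⟨MvPolynomial.aeval fun j => if j = ⟨i, hin⟩ then Polynomial.X else
      Polynomial.C (MvPolynomial.X j), fun j => by simp⟩
  let ψ : Polynomial (MvPolynomial (Fin n) R) →+* MvPolynomial (Fin n) R :=
    Polynomial.evalRingHom (MvPolynomial.X ⟨i, hin⟩)
  have hψC : ψ.comp Polynomial.C = RingHom.id _ := RingHom.ext fun r => by simp [ψ]
  have hψφ : ψ.comp φ.toRingHom = RingHom.id _ := by
    refine MvPolynomial.ringHom_ext (fun r => ?_) fun j => ?_
    · simp [ψ, ← MvPolynomial.algebraMap_eq, Polynomial.algebraMap_apply]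
    · by_cases h : j = ⟨i, hin⟩ <;> simp [ψ, hφ, h]
  -- The earlier polynomials do not involve the `i`-th variable, so `φ` sends each to the constant
  -- polynomial with the same value, and the extended ideal `I[T]` contains `φ(I)`.
  have hφI : I ≤ (I.map Polynomial.C).comap φ := by
    rw [← hI]
    refine Ideal.span_le.mpr fun y hy => ?_
    have hyI : y ∈ I := hI ▸ Ideal.subset_span hy
    rw [hI]
    obtain ⟨j, hj, rfl⟩ := List.mem_iff_getElem.mp hy
    simp only [List.length_take, List.length_ofFn, lt_inf_iff] at hj
    simp only [List.getElem_take, List.getElem_ofFn] at hyI ⊢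
    have h1 : φ (MvPolynomial.X ⟨j, hj.2⟩) =
        Polynomial.CAlgHom (R := R) (MvPolynomial.X ⟨j, hj.2⟩) := by
      simp [hφ, hj.1.ne]
    rw [SetLike.mem_coe, Ideal.mem_comap, ← Polynomial.aeval_algHom_apply, h1,
      Polynomial.aeval_algHom_apply]
    exact Ideal.mem_map_of_mem _ hyI
  have h1 := hφI hx
  rw [Ideal.mem_comap, map_mul, ← Polynomial.aeval_algHom_apply, hφ, if_pos rfl] at h1
  have h2 : Polynomial.aeval (Polynomial.X : Polynomial (MvPolynomial (Fin n) R)) (p ⟨i, hin⟩) =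
      (p ⟨i, hin⟩).map (algebraMap R _) := by
    rw [Polynomial.aeval_X_left_eq_map]
  rw [h2] at h1
  -- McCoy puts `φ x` in `I[T]`, and `ψ` brings this back to `x ∈ I`. The coefficients come from
  -- `R`, so an ideal of the larger ring containing them is tested on its contraction to `R`.
  have h3 := Ideal.mem_map_of_mem ψ (mem_map_C_of_mul_mem (fun J hJ => by
    have h := hp ⟨i, hin⟩ (J.comap (algebraMap R _)) fun m => by simpa using hJ m
    rw [Ideal.eq_top_iff_one] at h ⊢
    simpa using h) I h1)
  rw [Ideal.map_map, hψC, Ideal.map_id] at h3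
  rwa [show ψ (φ x) = x from RingHom.congr_fun hψφ x] at h3

/-- The Krull dimension drops by at least the length of a weakly regular sequence. -/
theorem ringKrullDim_quotient_ofList_add_length_le {R : Type*} [CommRing R] (rs : List R)
    (h : RingTheory.Sequence.IsWeaklyRegular R rs) :
    ringKrullDim (R ⧸ Ideal.ofList rs) + rs.length ≤ ringKrullDim R := by
  induction rs using List.reverseRecOn with
  | nil =>
    simpa using ringKrullDim_quotient_le (Ideal.ofList ([] : List R))
  | append_singleton rs r ih =>
    rw [isWeaklyRegular_iff_forall_mem] at h
    have hrs : RingTheory.Sequence.IsWeaklyRegular R rs := by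
      rw [isWeaklyRegular_iff_forall_mem]
      intro i hi
      have := h i (by simp; omega)
      rwa [List.take_append_of_le_length hi.le, List.getElem_append_left hi] at this
    have hr := h rs.length (by simp)
    rw [List.getElem_concat_length rfl, List.take_left' rfl] at hr
    set I := Ideal.ofList rs
    have hnzd : Ideal.Quotient.mk I r ∈ nonZeroDivisors (R ⧸ I) := by
      rw [mem_nonZeroDivisors_iff_right]
      intro y hy
      obtain ⟨x, rfl⟩ := Ideal.Quotient.mk_surjective y
      rw [← map_mul, Ideal.Quotient.eq_zero_iff_mem, mul_comm] at hy
      exact Ideal.Quotient.eq_zero_iff_mem.mpr (hr x hy)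
    have hle : I ≤ Ideal.ofList (rs ++ [r]) := by
      rw [Ideal.ofList_append]; exact le_sup_left
    -- Modulo the earlier terms `r` is a nonzerodivisor, and it dies in the next quotient; this
    -- costs one dimension.
    have h1 := ringKrullDim_succ_le_of_surjective (Ideal.Quotient.factor hle)
      (Ideal.Quotient.factor_surjective hle) hnzd (by
        rw [Ideal.Quotient.factor_mk, Ideal.Quotient.eq_zero_iff_mem]
        exact Ideal.subset_span (by simp))
    refine le_trans ?_ (ih hrs)
    rw [List.length_append, List.length_singleton, Nat.cast_add, Nat.cast_one,
      add_comm (rs.length : WithBot ℕ∞), ← add_assoc]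
    gcongr

end RegularSequence

/-! ### The coordinate rings of the charts of projective space. -/

section ChartRing

variable {k : Type u} [Field k] {m : ℕ}

/-- The constants in the ring of regular functions of a chart. -/
noncomputable def constants (k : Type u) [Field k] {m : ℕ} (a : Fin m) : k →+* ChartRing k m a :=
  (HomogeneousLocalization.fromZeroRingHom (grading k m) _).comp (algebraMap k (grading k m 0))

theorem val_constants (a : Fin m) (c : k) :
    (constants k a c).val = algebraMap (MvPolynomial (Fin m) k) _ (MvPolynomial.C c) := by
  change HomogeneousLocalization.val (HomogeneousLocalization.mk _) = _
  rw [HomogeneousLocalization.val_mk, ← Localization.mk_one_eq_algebraMap]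
  rfl

/-- The power `X a ^ d` as a denominator. -/
noncomputable def powX (k : Type u) [Field k] {m : ℕ} (a : Fin m) (d : ℕ) :
    Submonoid.powers (MvPolynomial.X a : MvPolynomial (Fin m) k) :=
  ⟨MvPolynomial.X a ^ d, d, rfl⟩

theorem val_coord (a b : Fin m) :
    (coord k a b).val = Localization.mk (MvPolynomial.X b) (powX k a 1) :=
  HomogeneousLocalization.Away.val_mk _ _ _ _ _

theorem coord_self (a : Fin m) : coord k a a = 1 := by
  apply HomogeneousLocalization.val_injective
  rw [val_coord, HomogeneousLocalization.val_one]
  refine Eq.trans ?_ (Localization.mk_self (powX k a 1))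
  exact congrArg (fun f => Localization.mk f (powX k a 1)) (pow_one _).symm

/-- Euler scaling. It is needed with `u = 1 / X a`, to collect the denominators of `f` evaluated at
the quotients `X b / X a`. -/
theorem pow_mul_eval₂Hom {R S : Type*} [CommRing R] [CommRing S] {d : ℕ}
    {f : MvPolynomial (Fin m) R} (hf : f.IsHomogeneous d) (c : R →+* S) (u : S) (v : Fin m → S) :
    MvPolynomial.eval₂Hom c (fun b => u * v b) f = u ^ d * MvPolynomial.eval₂Hom c v f := by
  rw [MvPolynomial.coe_eval₂Hom, MvPolynomial.coe_eval₂Hom, MvPolynomial.eval₂_eq,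
    MvPolynomial.eval₂_eq, Finset.mul_sum]
  refine Finset.sum_congr rfl fun s hs => ?_
  have hd : ∑ i ∈ s.support, s i = d := by
    have := hf (MvPolynomial.mem_support_iff.mp hs)
    rw [← this, Finsupp.weight_apply, Finsupp.sum]
    simp
  simp only [mul_pow, Finset.prod_mul_distrib, Finset.prod_pow_eq_pow_sum, hd]
  ring

/-- Dehomogenization as an identity of fractions. It shows that the quotients `X b / X a` generate
the chart ring, and it lets vector fields be computed on numerators. -/
theorem eval₂_coord_val (a : Fin m) {d : ℕ} {f : MvPolynomial (Fin m) k} (hf : f.IsHomogeneous d) :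
    (MvPolynomial.eval₂Hom (constants k a) (coord k a) f).val = Localization.mk f (powX k a d) := by
  let L := Localization (Submonoid.powers (MvPolynomial.X a : MvPolynomial (Fin m) k))
  let u : L := Localization.mk 1 (powX k a 1)
  have h1 : (algebraMap (ChartRing k m a) L).comp
        (MvPolynomial.eval₂Hom (constants k a) (coord k a)) =
      MvPolynomial.eval₂Hom ((algebraMap (MvPolynomial (Fin m) k) L).comp MvPolynomial.C)
        (fun b => u * algebraMap (MvPolynomial (Fin m) k) L (MvPolynomial.X b)) := by
    refine MvPolynomial.ringHom_ext (fun c => ?_) fun b => ?_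
    · simp only [RingHom.comp_apply, MvPolynomial.eval₂Hom_C]
      exact val_constants a c
    · simp only [RingHom.comp_apply, MvPolynomial.eval₂Hom_X', u]
      rw [HomogeneousLocalization.algebraMap_apply, val_coord, ← Localization.mk_one_eq_algebraMap,
        Localization.mk_mul, one_mul, mul_one]
  have h2 := RingHom.congr_fun h1 f
  rw [RingHom.comp_apply, HomogeneousLocalization.algebraMap_apply] at h2
  have h3 : Localization.mk f (powX k a d) = u ^ d * algebraMap _ L f := by
    rw [Localization.mk_pow, ← Localization.mk_one_eq_algebraMap, Localization.mk_mul, one_pow,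
      one_mul, mul_one]
    congr 1
    exact Subtype.ext (by simp [powX])
  have h4 : MvPolynomial.eval₂Hom ((algebraMap (MvPolynomial (Fin m) k) L).comp MvPolynomial.C)
      (fun b => algebraMap (MvPolynomial (Fin m) k) L (MvPolynomial.X b)) = algebraMap _ L := by
    refine MvPolynomial.ringHom_ext (fun c => ?_) fun b => ?_
    · rw [MvPolynomial.eval₂Hom_C, RingHom.comp_apply]
    · rw [MvPolynomial.eval₂Hom_X']
  rw [h2, h3, pow_mul_eval₂Hom hf, h4]

/-- The functions `X b / X a` generate the ring of regular functions of a chart. -/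
theorem eval₂_coord_surjective (a : Fin m) :
    Function.Surjective (MvPolynomial.eval₂Hom (constants k a) (coord k a)) := by
  intro x
  obtain ⟨d, f, hf, rfl⟩ := HomogeneousLocalization.Away.mk_surjective _ (X_mem_grading k a) x
  refine ⟨f, HomogeneousLocalization.val_injective _ ?_⟩
  rw [HomogeneousLocalization.Away.val_mk, eval₂_coord_val a (d := d) (by simpa using hf)]
  rfl

theorem chartRing_hom_ext {B : Type*} [CommRing B] {a : Fin m} {f g : ChartRing k m a →+* B}
    (h₀ : f.comp (constants k a) = g.comp (constants k a))
    (h : ∀ b, f (coord k a b) = g (coord k a b)) : f = g := by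
  have : f.comp (MvPolynomial.eval₂Hom (constants k a) (coord k a)) =
      g.comp (MvPolynomial.eval₂Hom (constants k a) (coord k a)) := by
    refine MvPolynomial.ringHom_ext (fun c => ?_) fun b => ?_
    · simpa using RingHom.congr_fun h₀ c
    · simpa using h b
  exact (RingHom.cancel_right (eval₂_coord_surjective a)).mp this

/-- Functions on a chart can be evaluated at every vector whose `a`-th coordinate is `1`. -/
noncomputable def chartLift {B : Type*} [CommRing B] (c : k →+* B) (a : Fin m) (v : Fin m → B)
    (hv : v a = 1) : ChartRing k m a →+* B :=
  (Localization.awayLift (MvPolynomial.eval₂Hom c v) (MvPolynomial.X a) (by simp [hv])).comp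
    (algebraMap (ChartRing k m a) (Localization.Away (MvPolynomial.X a : MvPolynomial (Fin m) k)))

theorem chartLift_constants {B : Type*} [CommRing B] (c : k →+* B) (a : Fin m) (v : Fin m → B)
    (hv : v a = 1) (x : k) : chartLift c a v hv (constants k a x) = c x := by
  rw [chartLift, RingHom.comp_apply, HomogeneousLocalization.algebraMap_apply, val_constants]
  simp [Localization.awayLift]

theorem chartLift_coord {B : Type*} [CommRing B] (c : k →+* B) (a : Fin m) (v : Fin m → B)
    (hv : v a = 1) (b : Fin m) : chartLift c a v hv (coord k a b) = v b := by
  rw [chartLift, RingHom.comp_apply, HomogeneousLocalization.algebraMap_apply, val_coord]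
  rw [Localization.mk_eq_mk', Localization.awayLift, IsLocalization.Away.lift,
    IsLocalization.lift_mk'_spec]
  simp [hv, powX]

theorem isNoetherianRing_chartRing (a : Fin m) : IsNoetherianRing (ChartRing k m a) :=
  isNoetherianRing_of_surjective _ _ _ (eval₂_coord_surjective a)

/-- The chart `D₊(X a)` of projective `m`-space has dimension at most `m`. -/
theorem ringKrullDim_chartRing_le (a : Fin (m + 1)) :
    ringKrullDim (ChartRing k (m + 1) a) ≤ m := by
  -- Since `X a / X a = 1`, the remaining `m` quotients already generate: substitute `1` for the
  -- `a`-th variable.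
  have hs : Function.Surjective (MvPolynomial.eval₂Hom (constants k a)
      (fun b => coord k a (a.succAbove b))) := by
    intro x
    obtain ⟨f, rfl⟩ := eval₂_coord_surjective a x
    refine ⟨MvPolynomial.eval₂Hom MvPolynomial.C
      (Fin.insertNth (α := fun _ => MvPolynomial (Fin m) k) a 1 MvPolynomial.X) f, ?_⟩
    refine RingHom.congr_fun (f := (MvPolynomial.eval₂Hom (constants k a)
      (fun b => coord k a (a.succAbove b))).comp (MvPolynomial.eval₂Hom MvPolynomial.C
      (Fin.insertNth (α := fun _ => MvPolynomial (Fin m) k) a 1 MvPolynomial.X))) ?_ f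
    refine MvPolynomial.ringHom_ext (fun c => by simp) fun b => ?_
    induction b using Fin.succAboveCases a with
    | x => simp [coord_self]
    | p b => simp
  refine (ringKrullDim_le_of_surjective _ hs).trans ?_
  simp

end ChartRing

/-! ### Vector fields on a chart of the projective line. -/

section VectorField

variable {k : Type u} [Field k]

theorem polyDer_X (A : Matrix (Fin 2) (Fin 2) k) (i : Fin 2) :
    polyDer A (MvPolynomial.X i) = ∑ j, MvPolynomial.C (A i j) * MvPolynomial.X j :=
  MvPolynomial.mkDerivation_X k _ i

theorem vectorField_constants (A : Matrix (Fin 2) (Fin 2) k) (a : Fin 2) (c : k) :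
    vectorField A a (constants k a c) = 0 := by
  change vectorField A a (HomogeneousLocalization.mk _) = _
  rw [vectorField_mk]
  apply HomogeneousLocalization.mk_eq_zero_of_num
  apply Subtype.ext
  change polyDer A (algebraMap k _ c) * 1 - (algebraMap k _ c) * polyDer A 1 = 0
  rw [Derivation.map_algebraMap, Derivation.map_one_eq_zero]
  simp

/-- The quotient rule for the functions `X b / X a`. -/
theorem vectorField_coord (A : Matrix (Fin 2) (Fin 2) k) (a b : Fin 2) :
    vectorField A a (coord k a b) =
      ∑ j, constants k a (A b j) * coord k a j -
        coord k a b * ∑ j, constants k a (A a j) * coord k a j := by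
  apply HomogeneousLocalization.val_injective
  have hs : ∀ b : Fin 2, (∑ j, constants k a (A b j) * coord k a j).val =
      Localization.mk (∑ j, MvPolynomial.C (A b j) * MvPolynomial.X j)
        (powX k a 1) := by
    intro b
    have h := eval₂_coord_val (k := k) a (d := 1)
      (f := ∑ j, MvPolynomial.C (A b j) * MvPolynomial.X j)
      (MvPolynomial.IsHomogeneous.sum _ _ _ fun j _ => MvPolynomial.isHomogeneous_C_mul_X _ _)
    simpa using h
  rw [HomogeneousLocalization.val_sub, HomogeneousLocalization.val_mul, hs, hs, val_coord,
    Localization.mk_mul]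
  change HomogeneousLocalization.val (HomogeneousLocalization.mk _) = _
  rw [HomogeneousLocalization.val_mk, sub_eq_add_neg, Localization.neg_mk, Localization.add_mk,
    Localization.mk_eq_mk_iff, Localization.r_iff_exists]
  refine ⟨1, ?_⟩
  simp only [quotientRule, powX, polyDer_X, Submonoid.coe_mul, OneMemClass.coe_one, one_mul,
    pow_one]
  ring

/-- Every vector field on a chart of `ℙ¹` is determined by its value on the affine coordinate. -/
theorem exists_vectorField_eq_mul (a : Fin 2) (f : ChartRing k 2 a) :
    ∃ f', ∀ A : Matrix (Fin 2) (Fin 2) k,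
      vectorField A a f = f' * vectorField A a (coord k a a.rev) := by
  -- The multiplier is `df/dt`, built by the Leibniz rule. It does not depend on `A`, which is what
  -- lets it leave the sum over the basis of `𝔰𝔩₂` in `sectionVal_eq`.
  obtain ⟨p, rfl⟩ := eval₂_coord_surjective a f
  induction p using MvPolynomial.induction_on with
  | C c => exact ⟨0, fun A => by simp [vectorField_constants]⟩
  | add p q hp hq =>
    obtain ⟨p', hp⟩ := hp
    obtain ⟨q', hq⟩ := hq
    exact ⟨p' + q', fun A => by rw [map_add, map_add, hp, hq, add_mul]⟩
  | mul_X p b hp =>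
    obtain ⟨p', hp⟩ := hp
    have hb : ∃ c, ∀ A : Matrix (Fin 2) (Fin 2) k,
        vectorField A a (coord k a b) = c * vectorField A a (coord k a a.rev) := by
      by_cases h : b = a
      · exact ⟨0, fun A => by rw [h, coord_self, Derivation.map_one_eq_zero, zero_mul]⟩
      · have : b = a.rev := by revert h; fin_cases a <;> fin_cases b <;> simp
        exact ⟨1, fun A => by rw [this, one_mul]⟩
    obtain ⟨c, hc⟩ := hb
    refine ⟨MvPolynomial.eval₂Hom (constants k a) (coord k a) p * c + coord k a b * p', fun A => ?_⟩
    rw [map_mul, Derivation.leibniz, hp, MvPolynomial.eval₂Hom_X', hc, smul_eq_mul, smul_eq_mul]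
    ring

end VectorField

/-! ### The standard charts of the product are spectra of polynomial rings. -/

section Charts

/-- Ring maps into functions on `U` correspond to morphisms from `U` to an affine scheme, even if
`U` is not affine. So identities between pullbacks of functions can be checked on morphisms. -/
theorem toSpecΓ_SpecMap_injective {X : Scheme.{u}} (U : X.Opens) {R : CommRingCat.{u}}
    {f g : R ⟶ Γ(X, U)} (h : U.toSpecΓ ≫ Spec.map f = U.toSpecΓ ≫ Spec.map g) : f = g := by
  have h1 := congrArg Scheme.Hom.appTop h
  rw [Scheme.Hom.comp_appTop, Scheme.Hom.comp_appTop, Scheme.Opens.toSpecΓ_appTop,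
    Scheme.ΓSpecIso_naturality_assoc, Scheme.ΓSpecIso_naturality_assoc,
    cancel_epi, cancel_mono] at h1
  exact h1

variable {k : Type u} [Field k]

/-- The open immersion of the chart `D₊(X a)`. -/
noncomputable def chartι (k : Type u) [Field k] {m : ℕ} (a : Fin m) :
    Spec (.of (ChartRing k m a)) ⟶ projSpace k m :=
  Proj.awayι (grading k m) (MvPolynomial.X a) (X_mem_grading k a) one_pos

instance isOpenImmersion_chartι {m : ℕ} (a : Fin m) : IsOpenImmersion (chartι k a) := by
  delta chartι; infer_instance

theorem opensRange_chartι {m : ℕ} (a : Fin m) : (chartι k a).opensRange = chart k m a :=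
  Proj.opensRange_awayι _ _ _ _

theorem chartι_projStr {m : ℕ} (a : Fin m) :
    chartι k a ≫ projStr k m = Spec.map (CommRingCat.ofHom (constants k a)) := by
  rw [chartι, projStr, Proj.awayι_toSpecZero_assoc, ← Spec.map_comp]
  rfl

/-- Pullback of functions on the chart `D₊(X a)`. -/
noncomputable def chartPullback {m : ℕ} {X : Scheme.{u}} (f : X ⟶ projSpace k m) (a : Fin m)
    (U : X.Opens) (h : U ≤ f ⁻¹ᵁ chart k m a) : ChartRing k m a →+* Γ(X, U) :=
  (Proj.awayToSection (grading k m) (MvPolynomial.X a) ≫ f.appLE (chart k m a) U h).hom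

theorem map_chartPullback {m : ℕ} {X : Scheme.{u}} (f : X ⟶ projSpace k m) (a : Fin m)
    {U V : X.Opens} (h : U ≤ f ⁻¹ᵁ chart k m a) (hV : V ≤ U) (x : ChartRing k m a) :
    X.presheaf.map (homOfLE hV).op (chartPullback f a U h x) =
      chartPullback f a V (hV.trans h) x := by
  have := f.appLE_map h (homOfLE hV).op
  exact congr($this (Proj.awayToSection (grading k m) (MvPolynomial.X a) x))

/-- The geometric characterization of `chartPullback`, used to pass between ring maps and the
projections of the product. -/
theorem toSpecΓ_chartPullback {m : ℕ} {X : Scheme.{u}} (f : X ⟶ projSpace k m) (a : Fin m)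
    (U : X.Opens) (h : U ≤ f ⁻¹ᵁ chart k m a) :
    U.toSpecΓ ≫ Spec.map (CommRingCat.ofHom (chartPullback f a U h)) ≫ chartι k a =
      U.ι ≫ f := by
  have h1 : CommRingCat.ofHom (chartPullback f a U h) =
    Proj.awayToSection (grading k m) (MvPolynomial.X a) ≫ f.appLE (chart k m a) U h := rfl
  have h2 : (chart k m a).toSpecΓ ≫ Spec.map (Proj.awayToSection (grading k m)
      (MvPolynomial.X a)) ≫ chartι k a = (chart k m a).ι := by
    have : (chart k m a).toSpecΓ ≫ Spec.map (Proj.awayToSection (grading k m)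
      (MvPolynomial.X a)) = (Proj.basicOpenIsoSpec (grading k m) (MvPolynomial.X a)
        (X_mem_grading k a) one_pos).hom := rfl
    rw [reassoc_of% this, chartι, Proj.awayι, Iso.hom_inv_id_assoc]
  rw [h1, Spec.map_comp, Category.assoc, Scheme.Opens.toSpecΓ_SpecMap_appLE_assoc, h2,
    Scheme.Hom.resLE_comp_ι]

theorem toSpecΓ_chartPullback_constants {m : ℕ} {X : Scheme.{u}} (f : X ⟶ projSpace k m)
    (a : Fin m) (U : X.Opens) (h : U ≤ f ⁻¹ᵁ chart k m a) :
    U.toSpecΓ ≫ Spec.map (CommRingCat.ofHom ((chartPullback f a U h).comp (constants k a))) =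
      U.ι ≫ f ≫ projStr k m := by
  rw [CommRingCat.ofHom_comp, Spec.map_comp, ← chartι_projStr,
    reassoc_of% toSpecΓ_chartPullback f a U h]

theorem chartPullback_constants_eq {m m' : ℕ} {X : Scheme.{u}} {f : X ⟶ projSpace k m}
    {f' : X ⟶ projSpace k m'} (hf : f ≫ projStr k m = f' ≫ projStr k m') {a : Fin m} {a' : Fin m'}
    {U : X.Opens} (h : U ≤ f ⁻¹ᵁ chart k m a) (h' : U ≤ f' ⁻¹ᵁ chart k m' a') :
    (chartPullback f a U h).comp (constants k a) =
      (chartPullback f' a' U h').comp (constants k a') := by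
  have := toSpecΓ_SpecMap_injective U (f := CommRingCat.ofHom _) (g := CommRingCat.ofHom _)
    ((toSpecΓ_chartPullback_constants f a U h).trans
    ((by rw [hf]) : _ = _) |>.trans (toSpecΓ_chartPullback_constants f' a' U h').symm)
  exact congrArg CommRingCat.Hom.hom this

theorem iSup_chart (m : ℕ) : ⨆ a, chart k m a = ⊤ := by
  refine Proj.iSup_basicOpen_eq_top' (grading k m) (fun a : Fin m => MvPolynomial.X a)
    (fun a => ⟨1, X_mem_grading k a⟩) ?_
  refine top_unique fun f _ => ?_
  induction f using MvPolynomial.induction_on with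
  | C c =>
    exact algebraMap_mem (Algebra.adjoin (grading k m 0) (Set.range fun a : Fin m =>
      (MvPolynomial.X a : MvPolynomial (Fin m) k)))
      (⟨MvPolynomial.C c, MvPolynomial.isHomogeneous_C _ c⟩ : grading k m 0)
  | add p q hp hq => exact add_mem (hp trivial) (hq trivial)
  | mul_X p a hp => exact mul_mem (hp trivial) (Algebra.subset_adjoin ⟨a, rfl⟩)

theorem exists_mem_chart {m : ℕ} (x : projSpace k m) : ∃ a, x ∈ chart k m a := by
  have : x ∈ ⨆ a, chart k m a := iSup_chart (k := k) m ▸ trivial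
  exact TopologicalSpace.Opens.mem_iSup.mp this

variable {n : ℕ}

theorem prP1_projStr (i : Fin n) : prP1 k i ≫ projStr k 2 = prLie k n ≫ projStr k 3 := by
  rw [prP1, Category.assoc, WidePullback.π_arrow, pullback.condition]
  rfl

theorem ambient_hom_ext {T : Scheme.{u}} {f g : T ⟶ ambient k n}
    (h₀ : f ≫ prLie k n = g ≫ prLie k n) (h : ∀ i, f ≫ prP1 k i = g ≫ prP1 k i) : f = g := by
  refine pullback.hom_ext (WidePullback.hom_ext _ _ _ (fun i => ?_) ?_) h₀
  · simpa [prP1] using h i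
  -- For `n = 0` the factors do not determine the component over the base, so it is read off from
  -- `ℙ(𝔰𝔩₂)`.
  · have := congrArg (· ≫ projStr k 3) h₀
    simpa [prLie, pullback.condition] using this

/-- The morphism to `(ℙ¹)ⁿ × ℙ(𝔰𝔩₂)` with given components. -/
noncomputable def ambientLift {T : Scheme.{u}} (f : T ⟶ projSpace k 3)
    (g : Fin n → (T ⟶ projSpace k 2)) (h : ∀ i, g i ≫ projStr k 2 = f ≫ projStr k 3) :
    T ⟶ ambient k n :=
  pullback.lift (WidePullback.lift (f ≫ projStr k 3) g h) f (WidePullback.lift_base _ _ _ _)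

theorem ambientLift_prLie {T : Scheme.{u}} (f : T ⟶ projSpace k 3)
    (g : Fin n → (T ⟶ projSpace k 2)) (h : ∀ i, g i ≫ projStr k 2 = f ≫ projStr k 3) :
    ambientLift f g h ≫ prLie k n = f :=
  pullback.lift_snd _ _ _

theorem ambientLift_prP1 {T : Scheme.{u}} (f : T ⟶ projSpace k 3)
    (g : Fin n → (T ⟶ projSpace k 2)) (h : ∀ i, g i ≫ projStr k 2 = f ≫ projStr k 3) (i : Fin n) :
    ambientLift f g h ≫ prP1 k i = g i := by
  rw [prP1, ambientLift, pullback.lift_fst_assoc, WidePullback.lift_π]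

/-- The standard affine chart of `(ℙ¹)ⁿ × ℙ(𝔰𝔩₂)`, where the `σ i`-th coordinate of the `i`-th
factor `ℙ¹` and the `j`-th coordinate of `ℙ(𝔰𝔩₂)` do not vanish. -/
noncomputable def stdOpen (k : Type u) [Field k] {n : ℕ} (σ : Fin n → Fin 2) (j : Fin 3) :
    (ambient k n).Opens :=
  prLie k n ⁻¹ᵁ chart k 3 j ⊓ ⨅ i, prP1 k i ⁻¹ᵁ chart k 2 (σ i)

theorem mem_stdOpen {σ : Fin n → Fin 2} {j : Fin 3} {w : ambient k n} :
    w ∈ stdOpen k σ j ↔ prLie k n w ∈ chart k 3 j ∧ ∀ i, prP1 k i w ∈ chart k 2 (σ i) := by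
  have : w ∈ (⨅ i, prP1 k i ⁻¹ᵁ chart k 2 (σ i)) ↔ ∀ i, prP1 k i w ∈ chart k 2 (σ i) := by
    rw [← SetLike.mem_coe, TopologicalSpace.Opens.coe_iInf, Set.mem_iInter]
    rfl
  rw [← this]
  rfl

theorem stdOpen_le_prLie (σ : Fin n → Fin 2) (j : Fin 3) :
    stdOpen k σ j ≤ prLie k n ⁻¹ᵁ chart k 3 j := inf_le_left

theorem stdOpen_le_prP1 (σ : Fin n → Fin 2) (j : Fin 3) (i : Fin n) :
    stdOpen k σ j ≤ prP1 k i ⁻¹ᵁ chart k 2 (σ i) := inf_le_right.trans (iInf_le _ i)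

theorem iSup_stdOpen : ⨆ c : (Fin n → Fin 2) × Fin 3, stdOpen k c.1 c.2 = ⊤ := by
  refine top_unique fun w _ => ?_
  obtain ⟨j, hj⟩ := exists_mem_chart (prLie k n w)
  choose σ hσ using fun i => exists_mem_chart (prP1 k (n := n) i w)
  exact TopologicalSpace.Opens.mem_iSup.mpr ⟨(σ, j), mem_stdOpen.mpr ⟨hj, hσ⟩⟩

/-- The coordinate ring of a standard affine chart, as a polynomial ring. -/
abbrev StdRing (k : Type u) [Field k] (n : ℕ) (j : Fin 3) : Type u :=
  MvPolynomial (Fin n) (ChartRing k 3 j)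

/-- The evaluation of polynomials as functions on a standard affine chart. -/
noncomputable def stdEval (k : Type u) [Field k] {n : ℕ} (σ : Fin n → Fin 2) (j : Fin 3) :
    StdRing k n j →+* Γ(ambient k n, stdOpen k σ j) :=
  MvPolynomial.eval₂Hom (chartPullback (prLie k n) j _ (stdOpen_le_prLie σ j))
    fun i => chartPullback (prP1 k i) (σ i) _ (stdOpen_le_prP1 σ j i) (coord k (σ i) (σ i).rev)

/-- The functions on the `i`-th factor `ℙ¹` as functions on a standard affine chart. -/
noncomputable def stdIncl (k : Type u) [Field k] {n : ℕ} (σ : Fin n → Fin 2) (j : Fin 3)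
    (i : Fin n) : ChartRing k 2 (σ i) →+* StdRing k n j :=
  chartLift (MvPolynomial.C.comp (constants k j)) (σ i)
    (fun b => if b = σ i then 1 else MvPolynomial.X i) (if_pos rfl)

theorem fin_two_eq_or (a b : Fin 2) : b = a ∨ b = a.rev := by
  revert a b; decide

theorem fin_two_rev_ne (a : Fin 2) : a.rev ≠ a := by
  revert a; decide

theorem stdIncl_coord_rev (σ : Fin n → Fin 2) (j : Fin 3) (i : Fin n) :
    stdIncl k σ j i (coord k (σ i) (σ i).rev) = MvPolynomial.X i := by
  rw [stdIncl, chartLift_coord, if_neg (fin_two_rev_ne _)]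

theorem stdIncl_comp_constants (σ : Fin n → Fin 2) (j : Fin 3) (i : Fin n) :
    (stdIncl k σ j i).comp (constants k (σ i)) = MvPolynomial.C.comp (constants k j) :=
  RingHom.ext fun c => chartLift_constants (MvPolynomial.C.comp (constants k j)) (σ i)
    (fun b => if b = σ i then 1 else MvPolynomial.X i) (if_pos rfl) c

theorem stdEval_comp_C (σ : Fin n → Fin 2) (j : Fin 3) :
    (stdEval k σ j).comp MvPolynomial.C =
      chartPullback (prLie k n) j _ (stdOpen_le_prLie σ j) :=
  MvPolynomial.eval₂Hom_comp_C _ _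

theorem stdEval_comp_stdIncl (σ : Fin n → Fin 2) (j : Fin 3) (i : Fin n) :
    (stdEval k σ j).comp (stdIncl k σ j i) =
      chartPullback (prP1 k i) (σ i) _ (stdOpen_le_prP1 σ j i) := by
  refine chartRing_hom_ext ?_ fun b => ?_
  · rw [chartPullback_constants_eq (prP1_projStr i) _ (stdOpen_le_prLie σ j),
      ← stdEval_comp_C, RingHom.comp_assoc, RingHom.comp_assoc, stdIncl_comp_constants]
  · rcases fin_two_eq_or (σ i) b with rfl | rfl
    · simp [coord_self]
    · rw [RingHom.comp_apply, stdIncl_coord_rev, stdEval, MvPolynomial.eval₂Hom_X']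

theorem stdRing_hom_ext {B : Type*} [CommRing B] (σ : Fin n → Fin 2) {j : Fin 3}
    {f g : StdRing k n j →+* B} (h₀ : f.comp MvPolynomial.C = g.comp MvPolynomial.C)
    (h : ∀ i, f.comp (stdIncl k σ j i) = g.comp (stdIncl k σ j i)) : f = g := by
  refine MvPolynomial.ringHom_ext' h₀ fun i => ?_
  have := RingHom.congr_fun (h i) (coord k (σ i) (σ i).rev)
  simpa [stdIncl_coord_rev] using this

/-- The counterpart of `ambient_hom_ext` on the polynomial side: the chart immersions are
monomorphisms, so components in the projective spaces determine the ring maps on the coefficients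
and on each variable. -/
theorem stdRing_spec_hom_ext {T : Scheme.{u}} (σ : Fin n → Fin 2) {j : Fin 3}
    {f g : T ⟶ Spec (.of (StdRing k n j))}
    (h₀ : f ≫ Spec.map (CommRingCat.ofHom MvPolynomial.C) ≫ chartι k j =
      g ≫ Spec.map (CommRingCat.ofHom MvPolynomial.C) ≫ chartι k j)
    (h : ∀ i, f ≫ Spec.map (CommRingCat.ofHom (stdIncl k σ j i)) ≫ chartι k (σ i) =
      g ≫ Spec.map (CommRingCat.ofHom (stdIncl k σ j i)) ≫ chartι k (σ i)) : f = g := by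
  have key : ∀ {S : CommRingCat.{u}} (c : S ⟶ CommRingCat.of (StdRing k n j))
      (_ : f ≫ Spec.map c = g ≫ Spec.map c),
      ((Scheme.ΓSpecIso _).inv ≫ f.appTop).hom.comp c.hom =
        ((Scheme.ΓSpecIso _).inv ≫ g.appTop).hom.comp c.hom := by
    intro S c hc
    have h1 := congrArg Scheme.Hom.appTop hc
    rw [Scheme.Hom.comp_appTop, Scheme.Hom.comp_appTop] at h1
    have h2 := congrArg (fun t => (Scheme.ΓSpecIso S).inv ≫ t) h1
    simp only [← Scheme.ΓSpecIso_inv_naturality_assoc] at h2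
    exact congrArg CommRingCat.Hom.hom h2
  refine ext_to_Spec ?_
  refine CommRingCat.hom_ext (stdRing_hom_ext σ (key (CommRingCat.ofHom MvPolynomial.C) ?_)
    fun i => key (CommRingCat.ofHom (stdIncl k σ j i)) ?_)
  · rw [← cancel_mono (chartι k j)]
    simpa using h₀
  · rw [← cancel_mono (chartι k (σ i))]
    simpa using h i

/-- The inverse of `stdEval` on spectra. -/
noncomputable def stdParam (k : Type u) [Field k] {n : ℕ} (σ : Fin n → Fin 2) (j : Fin 3) :
    Spec (.of (StdRing k n j)) ⟶ ambient k n :=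
  ambientLift (Spec.map (CommRingCat.ofHom MvPolynomial.C) ≫ chartι k j)
    (fun i => Spec.map (CommRingCat.ofHom (stdIncl k σ j i)) ≫ chartι k (σ i)) fun i => by
      rw [Category.assoc, Category.assoc, chartι_projStr, chartι_projStr, ← Spec.map_comp,
        ← Spec.map_comp, ← CommRingCat.ofHom_comp, ← CommRingCat.ofHom_comp,
        stdIncl_comp_constants]

theorem range_stdParam (σ : Fin n → Fin 2) (j : Fin 3) :
    Set.range (stdParam k σ j) ⊆ Set.range (stdOpen k σ j).ι := by
  rintro _ ⟨x, rfl⟩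
  rw [Scheme.Opens.range_ι]
  have hl : ∀ {m : ℕ} {a : Fin m} (p : ambient k n ⟶ projSpace k m)
      (c : Spec (.of (StdRing k n j)) ⟶ Spec (.of (ChartRing k m a)))
      (_ : stdParam k σ j ≫ p = c ≫ chartι k a), p (stdParam k σ j x) ∈ chart k m a := by
    intro m a p c hc
    rw [← Scheme.Hom.comp_apply, hc, Scheme.Hom.comp_apply, ← opensRange_chartι]
    exact ⟨_, rfl⟩
  exact mem_stdOpen.mpr ⟨hl _ _ (ambientLift_prLie _ _ _), fun i =>
    hl _ _ (ambientLift_prP1 _ _ _ i)⟩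

/-- Morphisms to either side are determined by their components in the projective spaces, and
`stdParam` has the right ones, so it gives a two-sided inverse. Affineness of the chart is a
consequence of this and not an input. -/
theorem isIso_toSpecΓ_stdEval (σ : Fin n → Fin 2) (j : Fin 3) :
    IsIso ((stdOpen k σ j).toSpecΓ ≫ Spec.map (CommRingCat.ofHom (stdEval k σ j))) := by
  let γ : Spec (.of (StdRing k n j)) ⟶ stdOpen k σ j :=
    IsOpenImmersion.lift (stdOpen k σ j).ι (stdParam k σ j) (range_stdParam σ j)
  have hγ : γ ≫ (stdOpen k σ j).ι = stdParam k σ j := IsOpenImmersion.lift_fac _ _ _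
  have h₀ : ((stdOpen k σ j).toSpecΓ ≫ Spec.map (CommRingCat.ofHom (stdEval k σ j))) ≫
      Spec.map (CommRingCat.ofHom MvPolynomial.C) ≫ chartι k j =
      (stdOpen k σ j).ι ≫ prLie k n := by
    rw [← toSpecΓ_chartPullback _ j _ (stdOpen_le_prLie σ j), ← stdEval_comp_C,
      CommRingCat.ofHom_comp, Spec.map_comp]
    simp only [Category.assoc]
  have h : ∀ i, ((stdOpen k σ j).toSpecΓ ≫ Spec.map (CommRingCat.ofHom (stdEval k σ j))) ≫
      Spec.map (CommRingCat.ofHom (stdIncl k σ j i)) ≫ chartι k (σ i) =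
      (stdOpen k σ j).ι ≫ prP1 k i := by
    intro i
    rw [← toSpecΓ_chartPullback _ _ _ (stdOpen_le_prP1 σ j i), ← stdEval_comp_stdIncl,
      CommRingCat.ofHom_comp, Spec.map_comp]
    simp only [Category.assoc]
  refine ⟨γ, ?_, ?_⟩
  · rw [← cancel_mono (stdOpen k σ j).ι, Category.assoc, hγ, Category.id_comp]
    refine ambient_hom_ext ?_ fun i => ?_
    · rw [Category.assoc, stdParam, ambientLift_prLie, h₀]
    · rw [Category.assoc, stdParam, ambientLift_prP1, h]
  · refine stdRing_spec_hom_ext σ ?_ fun i => ?_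
    · rw [Category.assoc, h₀, reassoc_of% hγ, stdParam, ambientLift_prLie, Category.id_comp]
    · rw [Category.assoc, h, reassoc_of% hγ, stdParam, ambientLift_prP1, Category.id_comp]

theorem isAffineOpen_stdOpen (σ : Fin n → Fin 2) (j : Fin 3) : IsAffineOpen (stdOpen k σ j) :=
  have := isIso_toSpecΓ_stdEval (k := k) σ j
  .of_isIso ((stdOpen k σ j).toSpecΓ ≫ Spec.map (CommRingCat.ofHom (stdEval k σ j)))

theorem stdEval_bijective (σ : Fin n → Fin 2) (j : Fin 3) :
    Function.Bijective (stdEval k σ j) := by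
  have h1 := isIso_toSpecΓ_stdEval (k := k) σ j
  have h2 : IsIso (stdOpen k σ j).toSpecΓ := by
    rw [← (isAffineOpen_stdOpen σ j).isoSpec_hom]; infer_instance
  have h3 : IsIso (Spec.map (CommRingCat.ofHom (stdEval k σ j))) :=
    IsIso.of_isIso_comp_left (stdOpen k σ j).toSpecΓ _
  exact isIso_SpecMap_iff.mp h3

/-- The coordinate ring of a standard affine chart is a polynomial ring. -/
noncomputable def stdEquiv (k : Type u) [Field k] {n : ℕ} (σ : Fin n → Fin 2) (j : Fin 3) :
    StdRing k n j ≃+* Γ(ambient k n, stdOpen k σ j) :=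
  RingEquiv.ofBijective (stdEval k σ j) (stdEval_bijective σ j)

end Charts

/-! ### Gluing ideal sheaves from an affine cover. -/

section IdealOfChart

variable {X : Scheme.{u}} {U : X.Opens} (hU : IsAffineOpen U) (I : Ideal Γ(X, U))

/-- The closed subscheme of an affine open subset with a given ideal, as a scheme over `X`. -/
noncomputable def affineSubscheme : Spec (.of (Γ(X, U) ⧸ I)) ⟶ X :=
  Spec.map (CommRingCat.ofHom (Ideal.Quotient.mk I)) ≫ hU.fromSpec

theorem affineSubscheme_preimage : affineSubscheme hU I ⁻¹ᵁ U = ⊤ := by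
  rw [affineSubscheme, Scheme.Hom.comp_preimage, hU.fromSpec_preimage_self]
  rfl

theorem affineSubscheme_appLE :
    (affineSubscheme hU I).appLE U ⊤ (affineSubscheme_preimage hU I).ge =
      CommRingCat.ofHom (Ideal.Quotient.mk I) ≫ (Scheme.ΓSpecIso _).inv := by
  have h1 : hU.fromSpec.appLE U ⊤ hU.fromSpec_preimage_self.ge = (Scheme.ΓSpecIso _).inv := by
    rw [Scheme.Hom.appLE, hU.fromSpec_app_self, Category.assoc, ← Functor.map_comp]
    exact (congrArg _ ((Spec Γ(X, U)).presheaf.map_id _)).trans (Category.comp_id _)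
  have h2 := Scheme.Hom.appLE_comp_appLE (Spec.map (CommRingCat.ofHom (Ideal.Quotient.mk I)))
    hU.fromSpec U ⊤ ⊤ hU.fromSpec_preimage_self.ge le_top
  refine h2.symm.trans ?_
  have h3 : (Spec.map (CommRingCat.ofHom (Ideal.Quotient.mk I))).appLE ⊤ ⊤ le_top =
      (Spec.map (CommRingCat.ofHom (Ideal.Quotient.mk I))).appTop := Scheme.Hom.appLE_eq_app _
  rw [h1, h3, Scheme.ΓSpecIso_inv_naturality]
  rfl

theorem affineSubscheme_app_eq_zero_iff (f : Γ(X, U)) :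
    (affineSubscheme hU I).app U f = 0 ↔ f ∈ I := by
  have h := congr($(affineSubscheme_appLE hU I) f)
  rw [← Ideal.Quotient.eq_zero_iff_mem]
  have h1 : (affineSubscheme hU I).appLE U ⊤ (affineSubscheme_preimage hU I).ge f =
      (Spec (.of (Γ(X, U) ⧸ I))).presheaf.map
        (homOfLE (affineSubscheme_preimage hU I).ge).op ((affineSubscheme hU I).app U f) := rfl
  have h2 : IsIso (homOfLE (affineSubscheme_preimage hU I).ge) :=
    ⟨homOfLE (affineSubscheme_preimage hU I).le, rfl, rfl⟩
  have h3 := (ConcreteCategory.bijective_of_isIso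
    ((Spec (.of (Γ(X, U) ⧸ I))).presheaf.map
      (homOfLE (affineSubscheme_preimage hU I).ge).op)).1
  have h4 := (ConcreteCategory.bijective_of_isIso
    (Scheme.ΓSpecIso (.of (Γ(X, U) ⧸ I))).inv).1
  rw [← map_eq_zero_iff _ h3, ← h1, h]
  exact map_eq_zero_iff _ h4

/-- The morphism lands in `U`, so only the restriction of `f` to `V ⊓ U` matters, and there the
extension of `I` pulls back to zero. -/
theorem affineSubscheme_app_eq_zero {V : X.Opens} (f : Γ(X, V))
    (h : X.presheaf.map (homOfLE (inf_le_left : V ⊓ U ≤ V)).op f ∈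
      I.map (X.presheaf.map (homOfLE (inf_le_right : V ⊓ U ≤ U)).op).hom) :
    (affineSubscheme hU I).app V f = 0 := by
  let p := affineSubscheme hU I
  have hle : p ⁻¹ᵁ (V ⊓ U) ≤ p ⁻¹ᵁ V := fun x hx => hx.1
  have hge : p ⁻¹ᵁ V ≤ p ⁻¹ᵁ (V ⊓ U) := fun x hx =>
    ⟨hx, (affineSubscheme_preimage hU I).ge trivial⟩
  have h2 : IsIso (homOfLE hle) := ⟨homOfLE hge, rfl, rfl⟩
  have h3 := (ConcreteCategory.bijective_of_isIso
    ((Spec (.of (Γ(X, U) ⧸ I))).presheaf.map (homOfLE hle).op)).1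
  have hnat : ∀ {V' : X.Opens} (hV : V ⊓ U ≤ V') (x : Γ(X, V')),
      p.app (V ⊓ U) (X.presheaf.map (homOfLE hV).op x) =
        (Spec (.of (Γ(X, U) ⧸ I))).presheaf.map
          (homOfLE (show p ⁻¹ᵁ (V ⊓ U) ≤ p ⁻¹ᵁ V' from fun x hx => hV hx)).op (p.app V' x) := by
    intro V' hV x
    exact congr($(p.naturality (homOfLE hV).op) x)
  have h4 : I.map (X.presheaf.map (homOfLE (inf_le_right : V ⊓ U ≤ U)).op).hom ≤
      RingHom.ker (p.app (V ⊓ U)).hom := by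
    rw [Ideal.map_le_iff_le_comap]
    intro x hx
    rw [Ideal.mem_comap, RingHom.mem_ker]
    refine (hnat inf_le_right x).trans ?_
    rw [(affineSubscheme_app_eq_zero_iff hU I x).mpr hx, map_zero]
  refine h3 ?_
  rw [map_zero, ← hnat inf_le_left]
  exact h4 h

theorem mem_ker_affineSubscheme [IsNoetherianRing Γ(X, U)] (V : X.affineOpens) (f : Γ(X, V.1)) :
    f ∈ (affineSubscheme hU I).ker.ideal V ↔ (affineSubscheme hU I).app V.1 f = 0 := by
  -- The source is the spectrum of a Noetherian ring, so the morphism is quasi-compact and its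
  -- kernel can be computed on affine opens.
  have : QuasiCompact (affineSubscheme hU I) := inferInstance
  rw [Scheme.Hom.ker_apply]
  rfl

/-- An ideal sheaf can be glued from compatible ideals on the members of a finite affine cover. -/
theorem exists_idealSheaf_of_cover {ι : Type*} [Finite ι] (U : ι → X.affineOpens)
    [∀ c, IsNoetherianRing Γ(X, (U c).1)] (I : ∀ c, Ideal Γ(X, (U c).1))
    (hI : ∀ c c', ∀ f ∈ I c',
      X.presheaf.map (homOfLE (inf_le_left : (U c').1 ⊓ (U c).1 ≤ (U c').1)).op f ∈
      (I c).map (X.presheaf.map (homOfLE (inf_le_right : (U c').1 ⊓ (U c).1 ≤ (U c).1)).op).hom) :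
    ∃ J : X.IdealSheafData, (∀ c, J.ideal (U c) = I c) ∧
      ∀ {V : X.Opens} (g : Γ(X, V)),
        (∀ c, X.presheaf.map (homOfLE (inf_le_left : V ⊓ (U c).1 ≤ V)).op g ∈
          (I c).map (X.presheaf.map (homOfLE (inf_le_right : V ⊓ (U c).1 ≤ (U c).1)).op).hom) →
        VanishesOn J g := by
  have hmem : ∀ (V : X.affineOpens) (f : Γ(X, V.1)),
      f ∈ (⨅ c, (affineSubscheme (U c).2 (I c)).ker).ideal V ↔
        ∀ c, (affineSubscheme (U c).2 (I c)).app V.1 f = 0 := by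
    intro V f
    rw [Scheme.IdealSheafData.ideal_iInf, iInf_apply, Submodule.mem_iInf]
    exact forall_congr' fun c => mem_ker_affineSubscheme (U c).2 (I c) V f
  -- The glued ideal consists of the functions that vanish on every piece. On the chart `c`, the
  -- piece `c` itself forces membership in `I c`; conversely `hI` makes elements of `I c` vanish on
  -- the other pieces.
  refine ⟨⨅ c, (affineSubscheme (U c).2 (I c)).ker, fun c => ?_, fun {V} g hg V' hV' => ?_⟩
  · ext f
    rw [hmem]
    refine ⟨fun h => (affineSubscheme_app_eq_zero_iff _ _ f).mp (h c), fun h c' => ?_⟩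
    exact affineSubscheme_app_eq_zero _ _ f (hI c' c f h)
  · rw [hmem]
    intro c
    refine (congr($((affineSubscheme (U c).2 (I c)).naturality (homOfLE hV').op) g)).trans ?_
    have := affineSubscheme_app_eq_zero (U c).2 (I c) g (hg c)
    exact (congrArg ((Spec (.of (Γ(X, (U c).1) ⧸ I c))).presheaf.map _).hom this).trans
      (map_zero _)

end IdealOfChart

/-! ### The forms `s_i` on charts and their transition factors. -/

section Forms

variable {k : Type u} [Field k]

theorem awayMap_coord {m : ℕ} (a a' b : Fin m) :
    HomogeneousLocalization.awayMap (grading k m) (X_mem_grading k a')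
        (rfl : (MvPolynomial.X a * MvPolynomial.X a' : MvPolynomial (Fin m) k) = _) (coord k a b) =
      HomogeneousLocalization.awayMap (grading k m) (X_mem_grading k a') rfl (coord k a a') *
      HomogeneousLocalization.awayMap (grading k m) (X_mem_grading k a)
        (mul_comm (MvPolynomial.X a) (MvPolynomial.X a')) (coord k a' b) := by
  simp only [coord, HomogeneousLocalization.awayMap_mk]
  apply HomogeneousLocalization.val_injective
  rw [HomogeneousLocalization.val_mul]
  simp only [HomogeneousLocalization.Away.val_mk]
  rw [Localization.mk_mul, Localization.mk_eq_mk_iff, Localization.r_iff_exists]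
  refine ⟨1, ?_⟩
  simp only [Submonoid.coe_mul, OneMemClass.coe_one, one_mul, pow_one]
  ring

/-- Factoring through the ring of the overlap of two charts makes functions from different charts
comparable. -/
theorem chartPullback_awayMap {m : ℕ} {X : Scheme.{u}} (f : X ⟶ projSpace k m) (a a' : Fin m)
    {x : MvPolynomial (Fin m) k} (hx : x = MvPolynomial.X a * MvPolynomial.X a') (U : X.Opens)
    (h : U ≤ f ⁻¹ᵁ chart k m a) (hU : U ≤ f ⁻¹ᵁ Proj.basicOpen (grading k m) x)
    (y : ChartRing k m a) :
    chartPullback f a U h y = (Proj.awayToSection (grading k m) x ≫ f.appLE _ U hU)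
      (HomogeneousLocalization.awayMap (grading k m) (X_mem_grading k a') hx y) := by
  have h1 := Proj.awayMap_awayToSection_assoc (grading k m) (X_mem_grading k a') hx (f.appLE _ U hU)
  rw [Scheme.Hom.map_appLE] at h1
  exact (congr($h1 y)).symm

/-- The change of coordinates between two charts of projective space. -/
theorem chartPullback_coord {m : ℕ} {X : Scheme.{u}} (f : X ⟶ projSpace k m) (a a' b : Fin m)
    (U : X.Opens) (h : U ≤ f ⁻¹ᵁ chart k m a) (h' : U ≤ f ⁻¹ᵁ chart k m a') :
    chartPullback f a U h (coord k a b) =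
      chartPullback f a U h (coord k a a') * chartPullback f a' U h' (coord k a' b) := by
  have hU : U ≤ f ⁻¹ᵁ Proj.basicOpen (grading k m) (MvPolynomial.X a * MvPolynomial.X a') := by
    rw [Proj.basicOpen_mul]
    exact le_inf h h'
  rw [chartPullback_awayMap f a a' rfl U h hU, chartPullback_awayMap f a a' rfl U h hU,
    chartPullback_awayMap f a' a (mul_comm _ _) U h' hU, ← map_mul, awayMap_coord]

variable {n : ℕ}

theorem opens_le_prP1 (i : Fin n) (a : Fin 2) (j : Fin 3) :
    opens k i a j ≤ prP1 k i ⁻¹ᵁ chart k 2 a := inf_le_left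

theorem opens_le_prLie (i : Fin n) (a : Fin 2) (j : Fin 3) :
    opens k i a j ≤ prLie k n ⁻¹ᵁ chart k 3 j := inf_le_right

theorem pullP1_eq (i : Fin n) (a : Fin 2) (j : Fin 3) :
    pullP1 k i a j = chartPullback (prP1 k i) a (opens k i a j) (opens_le_prP1 i a j) := rfl

theorem pullLie_eq (i : Fin n) (a : Fin 2) (j : Fin 3) :
    pullLie k i a j = chartPullback (prLie k n) j (opens k i a j) (opens_le_prLie i a j) := rfl

/-- This is `s(df) = (df/dt) s(dt)`: one component per factor controls the whole image of `s`. -/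
theorem sectionVal_eq (i : Fin n) (a : Fin 2) (j : Fin 3) (f : ChartRing k 2 a) :
    ∃ c, sectionVal k i a j f = c * sectionComponent k i a j := by
  obtain ⟨f', hf⟩ := exists_vectorField_eq_mul a f
  refine ⟨pullP1 k i a j f', ?_⟩
  rw [sectionComponent, sectionVal, sectionVal, Finset.mul_sum]
  refine Finset.sum_congr rfl fun b _ => ?_
  rw [hf, map_mul]
  ring

/-- The components of `s` are the forms `s_i`, up to a sign. -/
theorem sectionComponent_eq (i : Fin n) (a : Fin 2) (j : Fin 3) :
    sectionComponent k i a j = (-1) ^ (a : ℕ) * formVal k i a j := by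
  rw [sectionComponent, sectionVal, formVal, Fin.sum_univ_three]
  simp only [vectorField_coord, Fin.sum_univ_two, sl2Basis_zero, sl2Basis_one, sl2Basis_two]
  -- The tautological matrix gives `x' = Y₀x - X₀y` and `y' = Z₀x - Y₀y`, so `x y' - y x' = s_i`.
  -- For `a = 0` the coordinate is `y/x`; for `a = 1` it is `x/y`, which reverses the sign.
  fin_cases a
  · simp [coord_self, Fin.rev]
    ring
  · simp [coord_self, Fin.rev]
    ring

/-- The form `s_i`, dehomogenized on an open subset of a chart. -/
noncomputable def formOn (k : Type u) [Field k] {n : ℕ} (i : Fin n) (a : Fin 2) (j : Fin 3)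
    (U : (ambient k n).Opens) (h : U ≤ opens k i a j) : Γ(ambient k n, U) :=
  (ambient k n).presheaf.map (homOfLE h).op (formVal k i a j)

theorem formOn_eq (i : Fin n) (a : Fin 2) (j : Fin 3) (U : (ambient k n).Opens)
    (h : U ≤ opens k i a j) :
    formOn k i a j U h =
      chartPullback (prP1 k i) a U (h.trans (opens_le_prP1 i a j)) (coord k a 0) ^ 2 *
          chartPullback (prLie k n) j U (h.trans (opens_le_prLie i a j)) (coord k j 2)
        - 2 * chartPullback (prP1 k i) a U (h.trans (opens_le_prP1 i a j)) (coord k a 0) *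
          chartPullback (prP1 k i) a U (h.trans (opens_le_prP1 i a j)) (coord k a 1) *
          chartPullback (prLie k n) j U (h.trans (opens_le_prLie i a j)) (coord k j 1)
        + chartPullback (prP1 k i) a U (h.trans (opens_le_prP1 i a j)) (coord k a 1) ^ 2 *
          chartPullback (prLie k n) j U (h.trans (opens_le_prLie i a j)) (coord k j 0) := by
  have h1 := fun b => map_chartPullback (prP1 k i) a (opens_le_prP1 i a j) h (coord k a b)
  have h2 := fun b => map_chartPullback (prLie k n) j (opens_le_prLie i a j) h (coord k j b)
  simp only [formOn, formVal, map_add, map_sub, map_mul, map_pow, map_ofNat, pullP1_eq, pullLie_eq]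
  rw [h1 0, h1 1, h2 0, h2 1, h2 2]

theorem map_formOn (i : Fin n) (a : Fin 2) (j : Fin 3) {U V : (ambient k n).Opens}
    (h : U ≤ opens k i a j) (hV : V ≤ U) :
    (ambient k n).presheaf.map (homOfLE hV).op (formOn k i a j U h) =
      formOn k i a j V (hV.trans h) := by
  rw [formOn, formOn, ← CommRingCat.comp_apply, ← Functor.map_comp]
  rfl

/-- The change of the dehomogenized form between two charts. -/
theorem formOn_eq_mul (i : Fin n) (a a' : Fin 2) (j j' : Fin 3) (U : (ambient k n).Opens)
    (h : U ≤ opens k i a j) (h' : U ≤ opens k i a' j') :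
    ∃ c, formOn k i a j U h = c * formOn k i a' j' U h' := by
  -- The transition factor reflects that `s_i` has degree two on the factor `ℙ¹` and degree one on
  -- `ℙ(𝔰𝔩₂)`.
  refine ⟨chartPullback (prP1 k i) a U (h.trans (opens_le_prP1 i a j)) (coord k a a') ^ 2 *
    chartPullback (prLie k n) j U (h.trans (opens_le_prLie i a j)) (coord k j j'), ?_⟩
  rw [formOn_eq, formOn_eq]
  have h1 := fun b => chartPullback_coord (prP1 k i) a a' b U (h.trans (opens_le_prP1 i a j))
    (h'.trans (opens_le_prP1 i a' j'))
  have h2 := fun b => chartPullback_coord (prLie k n) j j' b U (h.trans (opens_le_prLie i a j))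
    (h'.trans (opens_le_prLie i a' j'))
  rw [h1 0, h1 1, h2 0, h2 1, h2 2]
  ring

end Forms

/-! ### The ideals of the zero locus and of the divisors on the charts. -/

section Loci

variable {k : Type u} [Field k] {n : ℕ}

theorem stdOpen_le_opens (σ : Fin n → Fin 2) (j : Fin 3) (i : Fin n) :
    stdOpen k σ j ≤ opens k i (σ i) j :=
  le_inf (stdOpen_le_prP1 σ j i) (stdOpen_le_prLie σ j)

theorem isNoetherianRing_stdRing (j : Fin 3) : IsNoetherianRing (StdRing k n j) :=
  have := isNoetherianRing_chartRing (k := k) j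
  inferInstance

theorem isNoetherianRing_stdOpen (σ : Fin n → Fin 2) (j : Fin 3) :
    IsNoetherianRing Γ(ambient k n, stdOpen k σ j) :=
  have := isNoetherianRing_stdRing (k := k) (n := n) j
  isNoetherianRing_of_ringEquiv _ (stdEquiv k σ j)

/-- The standard affine chart, as an affine open subset. -/
noncomputable def stdAffine (k : Type u) [Field k] {n : ℕ} (c : (Fin n → Fin 2) × Fin 3) :
    (ambient k n).affineOpens :=
  ⟨stdOpen k c.1 c.2, isAffineOpen_stdOpen c.1 c.2⟩

theorem iSup_stdAffine : ⨆ c, (stdAffine k (n := n) c).1 = ⊤ := iSup_stdOpen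

/-- An infimum of ideal sheaves gives no direct access to its sections. The transition formula
`formOn_eq_mul` makes the principal ideals on the charts compatible, so they glue. -/
theorem exists_formLocus_candidate (i : Fin n) :
    ∃ J : (ambient k n).IdealSheafData,
      (∀ c : (Fin n → Fin 2) × Fin 3, J.ideal (stdAffine k c) =
        Ideal.span {formOn k i (c.1 i) c.2 (stdAffine k c).1 (stdOpen_le_opens _ _ i)}) ∧
      ∀ (a : Fin 2) (j : Fin 3), VanishesOn J (formVal k i a j) := by
  have : ∀ c, IsNoetherianRing Γ(ambient k n, (stdAffine k (n := n) c).1) := fun c =>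
    isNoetherianRing_stdOpen c.1 c.2
  have key : ∀ (V : (ambient k n).Opens) (a : Fin 2) (j : Fin 3) (hV : V ≤ opens k i a j)
      (c : (Fin n → Fin 2) × Fin 3),
      (ambient k n).presheaf.map (homOfLE (inf_le_left : V ⊓ (stdAffine k c).1 ≤ V)).op
          (formOn k i a j V hV) ∈
        (Ideal.span {formOn k i (c.1 i) c.2 (stdAffine k c).1 (stdOpen_le_opens _ _ i)}).map
          ((ambient k n).presheaf.map (homOfLE (inf_le_right :
            V ⊓ (stdAffine k c).1 ≤ (stdAffine k c).1)).op).hom := by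
    intro V a j hV c
    obtain ⟨x, hx⟩ := formOn_eq_mul i a (c.1 i) j c.2 (V ⊓ (stdAffine k c).1)
      (inf_le_left.trans hV) (inf_le_right.trans (stdOpen_le_opens _ _ i))
    rw [map_formOn, hx, Ideal.map_span, Set.image_singleton, Ideal.mem_span_singleton]
    refine dvd_mul_of_dvd_right (dvd_of_eq ?_) _
    exact map_formOn _ _ _ _ _
  obtain ⟨J, hJ, hJ'⟩ := exists_idealSheaf_of_cover (stdAffine k (n := n))
    (fun c => Ideal.span {formOn k i (c.1 i) c.2 (stdAffine k c).1 (stdOpen_le_opens _ _ i)})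
    (by
      intro c c' f hf
      obtain ⟨y, rfl⟩ := Ideal.mem_span_singleton'.mp hf
      rw [map_mul]
      exact Ideal.mul_mem_left _ _ (key _ _ _ _ c))
  refine ⟨J, hJ, fun a j => hJ' _ fun c => ?_⟩
  convert key _ a j le_rfl c using 1
  rw [map_formOn]
  rfl

/-- The glued candidate belongs to the family whose infimum is taken, and every member of the family
contains its generator on each chart. -/
theorem formLocus_spec (i : Fin n) :
    (∀ c : (Fin n → Fin 2) × Fin 3, (formLocus k i).ideal (stdAffine k c) =
      Ideal.span {formOn k i (c.1 i) c.2 (stdAffine k c).1 (stdOpen_le_opens _ _ i)}) ∧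
    ∀ (a : Fin 2) (j : Fin 3), VanishesOn (formLocus k i) (formVal k i a j) := by
  obtain ⟨J, hJ, hJ'⟩ := exists_formLocus_candidate (k := k) i
  have : formLocus k i = J := by
    refine le_antisymm (sInf_le hJ') (le_sInf fun K hK => ?_)
    refine Scheme.IdealSheafData.le_of_iSup_eq_top (stdAffine k) iSup_stdAffine fun c => ?_
    rw [hJ, Ideal.span_singleton_le_iff_mem]
    exact hK (c.1 i) c.2 (stdAffine k c) (stdOpen_le_opens _ _ i)
  rw [this]
  exact ⟨hJ, hJ'⟩

theorem VanishesOn.mono {W : Scheme.{u}} {J J' : W.IdealSheafData} (hJ : J ≤ J') {V : W.Opens}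
    {g : Γ(W, V)} (h : VanishesOn J g) : VanishesOn J' g :=
  fun U hU => hJ U (h U hU)

theorem VanishesOn.mul_left {W : Scheme.{u}} {J : W.IdealSheafData} {V : W.Opens}
    {g : Γ(W, V)} (h : VanishesOn J g) (c : Γ(W, V)) : VanishesOn J (c * g) := by
  intro U hU
  rw [map_mul]
  exact Ideal.mul_mem_left _ _ (h U hU)

/-- The zero locus of `s` is the intersection of the divisors `s_i = 0`. -/
theorem zeroLocus_eq : zeroLocus k n = ⨆ i : Fin n, formLocus k i := by
  refine le_antisymm (sInf_le fun i a j f => ?_) (iSup_le fun i => le_sInf fun J hJ => ?_)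
  · obtain ⟨c, hc⟩ := sectionVal_eq i a j f
    rw [hc, sectionComponent_eq]
    exact ((((formLocus_spec i).2 a j).mono (le_iSup _ i)).mul_left _).mul_left _
  · refine sInf_le fun a j => ?_
    have h : formVal k i a j = (-1) ^ (a : ℕ) * sectionComponent k i a j := by
      rw [sectionComponent_eq, ← mul_assoc, ← mul_pow]
      simp
    rw [h]
    exact VanishesOn.mul_left (hJ i a j _) _

/-- The components of `s` in the frames over a standard affine chart. -/
noncomputable def componentOn (k : Type u) [Field k] {n : ℕ} (σ : Fin n → Fin 2) (j : Fin 3)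
    (i : Fin n) : Γ(ambient k n, stdOpen k σ j) :=
  (ambient k n).presheaf.map (homOfLE (stdOpen_le_opens σ j i)).op (sectionComponent k i (σ i) j)

theorem componentOn_eq (σ : Fin n → Fin 2) (j : Fin 3) (i : Fin n) :
    componentOn k σ j i = (-1) ^ (σ i : ℕ) * formOn k i (σ i) j _ (stdOpen_le_opens σ j i) := by
  rw [componentOn, sectionComponent_eq, map_mul, map_pow, map_neg, map_one]
  rfl

/-- Suprema of ideal sheaves are computed on each affine open, and the signs are units. -/
theorem zeroLocus_ideal (c : (Fin n → Fin 2) × Fin 3) :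
    (zeroLocus k n).ideal (stdAffine k c) =
      Ideal.span (Set.range (componentOn k c.1 c.2)) := by
  rw [zeroLocus_eq, Scheme.IdealSheafData.ideal_iSup, iSup_apply, Ideal.span_range_eq_iSup]
  refine iSup_congr fun i => ?_
  rw [(formLocus_spec i).1 c, componentOn_eq]
  exact (Ideal.span_singleton_mul_left_unit ((isUnit_one.neg).pow _) _).symm

end Loci

/-! ### Krull dimension of a closed subscheme via affine charts. -/

section Dimension

/-- The dimension of a space is determined on an open cover. -/
theorem topologicalKrullDim_le_of_openCover {X : Type*} [TopologicalSpace X] {ι : Type*}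
    {Y : ι → Type*} [∀ c, TopologicalSpace (Y c)] (f : ∀ c, Y c → X)
    (hf : ∀ c, Topology.IsOpenEmbedding (f c)) (hX : ∀ x, ∃ c, x ∈ Set.range (f c))
    {d : WithBot ℕ∞} (hd : ∀ c, topologicalKrullDim (Y c) ≤ d) : topologicalKrullDim X ≤ d := by
  -- Coheight is the right invariant: chains going up from `Z` consist of sets containing `Z`, so
  -- they all meet any open set that meets `Z`, and no length is lost by restricting to it.
  rw [topologicalKrullDim, Order.krullDim_eq_iSup_coheight]
  refine iSup_le fun Z => ?_
  obtain ⟨x, hx⟩ := Z.isIrreducible.nonempty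
  obtain ⟨c, y, rfl⟩ := hX x
  let e := TopologicalSpace.IrreducibleCloseds.orderIsoOfIsOpenEmbedding (f c) (hf c)
  have hZ : TopologicalSpace.IrreducibleCloseds.map (f c) (hf c).continuous (e.symm ⟨Z, y, hx⟩) =
      Z := congrArg Subtype.val (e.apply_symm_apply ⟨Z, y, hx⟩)
  rw [← hZ, (hf c).coheight_map]
  exact (Order.coheight_le_krullDim _).trans (hd c)

variable {X : Scheme.{u}} (J : X.IdealSheafData)

theorem topologicalKrullDim_Spec (R : CommRingCat.{u}) :
    topologicalKrullDim (Spec R) = ringKrullDim R :=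
  PrimeSpectrum.topologicalKrullDim_eq_ringKrullDim R

theorem ringKrullDim_le_topologicalKrullDim_subscheme (U : X.affineOpens) :
    ringKrullDim (Γ(X, U.1) ⧸ J.ideal U) ≤ topologicalKrullDim J.subscheme := by
  have := J.subschemeCover.map_prop U
  have h := (J.subschemeCover.f U).isOpenEmbedding.isInducing.topologicalKrullDim_le
  exact (topologicalKrullDim_Spec (.of (Γ(X, U.1) ⧸ J.ideal U))).symm.le.trans h

theorem topologicalKrullDim_subscheme_le {ι : Type*} (U : ι → X.affineOpens)
    (hU : ⨆ c, (U c).1 = ⊤) {d : WithBot ℕ∞}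
    (hd : ∀ c, ringKrullDim (Γ(X, (U c).1) ⧸ J.ideal (U c)) ≤ d) :
    topologicalKrullDim J.subscheme ≤ d := by
  have := fun c => J.subschemeCover.map_prop (U c)
  refine topologicalKrullDim_le_of_openCover (fun c => J.subschemeCover.f (U c))
    (fun c => (J.subschemeCover.f (U c)).isOpenEmbedding) (fun x => ?_) fun c =>
      (topologicalKrullDim_Spec (.of (Γ(X, (U c).1) ⧸ J.ideal (U c)))).le.trans (hd c)
  have hx : J.subschemeι x ∈ ⨆ c, (U c).1 := hU ▸ trivial
  obtain ⟨c, hc⟩ := TopologicalSpace.Opens.mem_iSup.mp hx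
  refine ⟨c, ?_⟩
  have : x ∈ (J.subschemeCover.f (U c)).opensRange := by
    rw [J.opensRange_subschemeCover_map]
    exact hc
  exact this

end Dimension

/-! ### Regularity of the components of `s`. -/

section Regular

variable {k : Type u} [Field k] {n : ℕ}

/-- The component of `s` on a standard affine chart, as a polynomial in the coordinate of the
corresponding factor `ℙ¹`. -/
noncomputable def componentPoly (k : Type u) [Field k] (a : Fin 2) (j : Fin 3) :
    Polynomial (ChartRing k 3 j) :=
  let u : Fin 2 → Polynomial (ChartRing k 3 j) := fun b => if b = a then 1 else Polynomial.X
  (-1) ^ (a : ℕ) * (u 0 ^ 2 * Polynomial.C (coord k j 2)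
    - 2 * u 0 * u 1 * Polynomial.C (coord k j 1) + u 1 ^ 2 * Polynomial.C (coord k j 0))

theorem stdEval_componentPoly (σ : Fin n → Fin 2) (j : Fin 3) (i : Fin n) :
    stdEval k σ j (Polynomial.aeval (MvPolynomial.X i) (componentPoly k (σ i) j)) =
      componentOn k σ j i := by
  have hC : ∀ r, stdEval k σ j (Polynomial.aeval (MvPolynomial.X i) (Polynomial.C r)) =
      chartPullback (prLie k n) j _ (stdOpen_le_prLie σ j) r := by
    intro r
    rw [Polynomial.aeval_C, MvPolynomial.algebraMap_eq]
    exact RingHom.congr_fun (stdEval_comp_C σ j) r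
  have hu : ∀ b : Fin 2, stdEval k σ j (Polynomial.aeval (MvPolynomial.X i)
      (if b = σ i then (1 : Polynomial (ChartRing k 3 j)) else Polynomial.X)) =
        chartPullback (prP1 k i) (σ i) _ (stdOpen_le_prP1 σ j i) (coord k (σ i) b) := by
    intro b
    rcases fin_two_eq_or (σ i) b with rfl | rfl
    · simp [coord_self]
    · rw [if_neg (fin_two_rev_ne _), Polynomial.aeval_X, stdEval, MvPolynomial.eval₂Hom_X']
  rw [componentOn_eq, formOn_eq, componentPoly]
  simp only [map_mul, map_add, map_sub, map_pow, map_neg, map_one, map_ofNat]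
  rw [hC, hC, hC, hu, hu]

/-- The coefficients are the coordinates on the chart of `ℙ(𝔰𝔩₂)` up to sign and a factor `2`, and
the `j`-th coordinate is `1`. Inverting `2` is essential: otherwise the form could vanish
identically over `X₀ = Z₀ = 0`. -/
theorem coeff_componentPoly_generate [CharZero k] (a : Fin 2) (j : Fin 3)
    (I : Ideal (ChartRing k 3 j)) (hI : ∀ m, (componentPoly k a j).coeff m ∈ I) : I = ⊤ := by
  have h2 : ∀ x, 2 * x ∈ I → x ∈ I := by
    intro x hx
    have h : constants k j 2⁻¹ * 2 = 1 := by
      rw [← map_ofNat (constants k j) 2, ← map_mul, inv_mul_cancel₀ two_ne_zero, map_one]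
    have := I.mul_mem_left (constants k j 2⁻¹) hx
    rwa [← mul_assoc, h, one_mul] at this
  have hall : coord k j 0 ∈ I ∧ coord k j 1 ∈ I ∧ coord k j 2 ∈ I := by
    have c0 := hI 0
    have c1 := hI 1
    have c2 := hI 2
    have e2 : (2 : Polynomial (ChartRing k 3 j)) = Polynomial.C 2 := rfl
    fin_cases a
    · have hp : componentPoly k 0 j = Polynomial.C (coord k j 2)
          + Polynomial.C (-(2 * coord k j 1)) * Polynomial.X
          + Polynomial.C (coord k j 0) * Polynomial.X ^ 2 := by
        simp only [componentPoly, Fin.val_zero, pow_zero, if_true, one_ne_zero, if_false, e2,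
          map_neg, map_mul]
        ring
      change (componentPoly k 0 j).coeff 0 ∈ I at c0
      change (componentPoly k 0 j).coeff 1 ∈ I at c1
      change (componentPoly k 0 j).coeff 2 ∈ I at c2
      rw [hp] at c0 c1 c2
      simp [-map_neg, -map_mul, Polynomial.coeff_X, Polynomial.coeff_C, Polynomial.coeff_X_pow]
        at c0 c1 c2
      exact ⟨c2, h2 _ c1, c0⟩
    · have hp : componentPoly k 1 j = Polynomial.C (-coord k j 0)
          + Polynomial.C (2 * coord k j 1) * Polynomial.X
          + Polynomial.C (-coord k j 2) * Polynomial.X ^ 2 := by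
        simp only [componentPoly, Fin.val_one, pow_one, if_true, zero_ne_one, if_false, e2,
          map_neg, map_mul]
        ring
      change (componentPoly k 1 j).coeff 0 ∈ I at c0
      change (componentPoly k 1 j).coeff 1 ∈ I at c1
      change (componentPoly k 1 j).coeff 2 ∈ I at c2
      rw [hp] at c0 c1 c2
      simp [-map_neg, -map_mul, Polynomial.coeff_X, Polynomial.coeff_C, Polynomial.coeff_X_pow]
        at c0 c1 c2
      exact ⟨c0, h2 _ c1, c2⟩
  rw [Ideal.eq_top_iff_one, ← coord_self (k := k) j]
  fin_cases j
  · exact hall.1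
  · exact hall.2.1
  · exact hall.2.2

theorem isWeaklyRegular_componentOn [CharZero k] (σ : Fin n → Fin 2) (j : Fin 3) :
    RingTheory.Sequence.IsWeaklyRegular Γ(ambient k n, stdOpen k σ j)
      (List.ofFn (componentOn k σ j)) := by
  have h := isWeaklyRegular_ofFn_aeval_X (fun i => componentPoly k (σ i) j)
    fun i => coeff_componentPoly_generate (k := k) (σ i) j
  refine (AddEquiv.isWeaklyRegular_congr (e := (stdEquiv k σ j).toAddEquiv) ?_).mp h
  have : List.ofFn (componentOn k σ j) = (List.ofFn fun i => Polynomial.aeval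
      (MvPolynomial.X i : StdRing k n j) (componentPoly k (σ i) j)).map (stdEquiv k σ j) := by
    rw [List.map_ofFn]
    exact congrArg List.ofFn (funext fun i => (stdEval_componentPoly σ j i).symm)
  rw [this]
  exact List.forall₂_map_right_iff.mpr (List.forall₂_same.mpr fun r _ x =>
    map_mul (stdEquiv k σ j) r x)

/-- The stalk is a localization of the chart ring, so weak regularity is inherited. Since `w` lies
on `M`, the germs are in the maximal ideal, which upgrades this to regularity. -/
theorem isRegular_germ_componentOn [CharZero k] {w : ambient k n}
    (hw : w ∈ (zeroLocus k n).support) (σ : Fin n → Fin 2) (j : Fin 3) (h : w ∈ stdOpen k σ j) :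
    RingTheory.Sequence.IsRegular ((ambient k n).presheaf.stalk w)
      (List.ofFn fun i => (ambient k n).presheaf.germ _ w h (componentOn k σ j i)) := by
  refine RingTheory.Sequence.IsRegular.of_isWeaklyRegular_of_mem_maximalIdeal _ ?_ ?_
  · intro r hr
    obtain ⟨i, rfl⟩ := List.mem_ofFn.mp hr
    rw [IsLocalRing.mem_maximalIdeal, mem_nonunits_iff, ← Scheme.mem_basicOpen]
    have h1 := (Scheme.IdealSheafData.mem_support_iff_of_mem (U := stdAffine k (σ, j)) h).mp hw
    have hm : componentOn k σ j i ∈ (zeroLocus k n).ideal (stdAffine k (σ, j)) := by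
      rw [zeroLocus_ideal]
      exact Ideal.subset_span ⟨i, rfl⟩
    exact (Scheme.mem_zeroLocus_iff _ _ _).mp h1 _ hm
  · let := TopCat.Presheaf.algebra_section_stalk (ambient k n).presheaf
      (⟨w, h⟩ : stdOpen k σ j)
    have hl := (isAffineOpen_stdOpen (k := k) σ j).isLocalization_stalk ⟨w, h⟩
    have := (isWeaklyRegular_componentOn (k := k) σ j).of_isLocalization
      ((ambient k n).presheaf.stalk w)
      ((isAffineOpen_stdOpen (k := k) σ j).primeIdealOf ⟨w, h⟩).asIdeal.primeCompl
    rw [List.map_ofFn] at this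
    exact this

theorem germ_componentOn {w : ambient k n} (σ : Fin n → Fin 2) (j : Fin 3)
    (h : w ∈ stdOpen k σ j) (i : Fin n) :
    (ambient k n).presheaf.germ _ w h (componentOn k σ j i) =
      (ambient k n).presheaf.germ _ w (stdOpen_le_opens σ j i h)
        (sectionComponent k i (σ i) j) :=
  TopCat.Presheaf.germ_res_apply _ _ _ _ _

theorem isLocalCompleteIntersection_zeroLocus [CharZero k] :
    IsLocalCompleteIntersection (zeroLocus k n) n := by
  intro w hw
  have h : w ∈ ⨆ c : (Fin n → Fin 2) × Fin 3, stdOpen k c.1 c.2 := by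
    rw [iSup_stdOpen]
    trivial
  obtain ⟨c, hc⟩ := TopologicalSpace.Opens.mem_iSup.mp h
  exact ⟨stdAffine k c, hc, componentOn k c.1 c.2, zeroLocus_ideal c,
    isRegular_germ_componentOn hw c.1 c.2 hc⟩

end Regular

/-! ### The dimension of the zero locus, and regularity in arbitrary frames. -/

section DimensionTwo

variable {k : Type u} [Field k] {n : ℕ}

theorem ringKrullDim_stdOpen_le (σ : Fin n → Fin 2) (j : Fin 3) :
    ringKrullDim Γ(ambient k n, stdOpen k σ j) ≤ 2 + n := by
  have := isNoetherianRing_chartRing (k := k) j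
  rw [← ringKrullDim_eq_of_ringEquiv (stdEquiv k σ j),
    MvPolynomial.ringKrullDim_of_isNoetherianRing, Nat.card_eq_fintype_card, Fintype.card_fin]
  exact add_le_add_left (ringKrullDim_chartRing_le (m := 2) j) _

theorem topologicalKrullDim_zeroLocus_le [CharZero k] :
    topologicalKrullDim (zeroLocus k n).subscheme ≤ 2 := by
  refine topologicalKrullDim_subscheme_le _ (stdAffine k) iSup_stdAffine fun c => ?_
  have h := ringKrullDim_quotient_ofList_add_length_le _
    (isWeaklyRegular_componentOn (k := k) c.1 c.2)
  have e : Ideal.ofList (List.ofFn (componentOn k c.1 c.2)) =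
      (zeroLocus k n).ideal (stdAffine k c) := by
    rw [zeroLocus_ideal, Ideal.ofList]
    congr 1
    ext
    simp [List.mem_ofFn]
  rw [e, List.length_ofFn] at h
  exact ENat.WithBot.add_le_add_natCast_right_iff.mp (h.trans (ringKrullDim_stdOpen_le c.1 c.2))

/-- The coordinates on the Lie algebra of the vector fields on `ℙ¹` with a given zero. -/
noncomputable def surfaceCoord (k : Type u) [Field k] (n : ℕ) : Fin 3 → MvPolynomial (Fin 2) k :=
  -- With `Z₀ = 1`, `t = x/y` the variable `X 0` and `Y₀` the variable `X 1`, this solves `t² - 2tY₀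
  -- + X₀ = 0` for `X₀`. For `n = 0` there is no equation, and `X₀` itself is the free variable.
  ![if n = 0 then MvPolynomial.X 0 else
    2 * MvPolynomial.X 1 * MvPolynomial.X 0 - MvPolynomial.X 0 ^ 2, MvPolynomial.X 1, 1]

theorem surfaceCoord_two : surfaceCoord k n 2 = 1 := rfl

/-- The restriction of functions to a surface that is contained in the zero locus: the pairs of an
element of the Lie algebra and a zero of its vector field, embedded diagonally. -/
noncomputable def surfaceEval (k : Type u) [Field k] (n : ℕ) :
    StdRing k n 2 →+* MvPolynomial (Fin 2) k :=
  MvPolynomial.eval₂Hom (chartLift MvPolynomial.C 2 (surfaceCoord k n) surfaceCoord_two)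
    fun _ => MvPolynomial.X 0

theorem surfaceEval_C_coord (b : Fin 3) :
    surfaceEval k n (MvPolynomial.C (coord k 2 b)) = surfaceCoord k n b := by
  rw [surfaceEval, MvPolynomial.coe_eval₂Hom, MvPolynomial.eval₂_C, chartLift_coord]

theorem surfaceEval_X (i : Fin n) :
    surfaceEval k n (MvPolynomial.X i) = MvPolynomial.X 0 := by
  rw [surfaceEval, MvPolynomial.eval₂Hom_X']

theorem surfaceEval_surjective : Function.Surjective (surfaceEval k n) := by
  intro p
  rw [← RingHom.mem_range]
  induction p using MvPolynomial.induction_on with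
  | C c =>
    refine ⟨MvPolynomial.C (constants k 2 c), ?_⟩
    rw [surfaceEval, MvPolynomial.coe_eval₂Hom, MvPolynomial.eval₂_C, chartLift_constants]
  | add p q hp hq => exact add_mem hp hq
  | mul_X p i hp =>
    refine mul_mem hp ?_
    fin_cases i
    -- For `n = 0` the first variable is hit by `X₀`; otherwise it is hit by the coordinate of any
    -- factor `ℙ¹`.
    · rcases n with - | n
      · exact ⟨_, (surfaceEval_C_coord 0).trans (by simp [surfaceCoord])⟩
      · exact ⟨_, surfaceEval_X 0⟩
    · exact ⟨_, (surfaceEval_C_coord 1).trans (by simp [surfaceCoord])⟩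

theorem surfaceEval_componentPoly (i : Fin n) :
    surfaceEval k n (Polynomial.aeval (MvPolynomial.X i) (componentPoly k 1 2)) = 0 := by
  have hn : n ≠ 0 := (Fin.pos i).ne'
  have hC : ∀ r, Polynomial.aeval (MvPolynomial.X i : StdRing k n 2) (Polynomial.C r) =
      MvPolynomial.C r := fun r => Polynomial.aeval_C _ r
  simp only [componentPoly, map_mul, map_add, map_sub, map_pow, map_neg, map_one, map_ofNat,
    zero_ne_one, if_false, if_true, Polynomial.aeval_X, hC, surfaceEval_C_coord, surfaceEval_X,
    surfaceCoord, if_neg hn]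
  simp
  ring

/-- On the chart `Z₀ ≠ 0`, all `y_i ≠ 0`, restriction to the surface kills the components of `s`, so
the coordinate ring of `M` surjects onto a polynomial ring in two variables over `k`. -/
theorem two_le_topologicalKrullDim_zeroLocus :
    2 ≤ topologicalKrullDim (zeroLocus k n).subscheme := by
  let c : (Fin n → Fin 2) × Fin 3 := (fun _ => 1, 2)
  let e := stdEquiv k c.1 c.2
  refine le_trans ?_ (ringKrullDim_le_topologicalKrullDim_subscheme _ (stdAffine k c))
  have h0 : ∀ r ∈ (zeroLocus k n).ideal (stdAffine k c),
      (surfaceEval k n).comp e.symm.toRingHom r = 0 := by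
    change (zeroLocus k n).ideal (stdAffine k c) ≤
      RingHom.ker ((surfaceEval k n).comp e.symm.toRingHom)
    rw [zeroLocus_ideal]
    refine Ideal.span_le.mpr ?_
    rintro _ ⟨i, rfl⟩
    have h1 : e.symm (componentOn k c.1 c.2 i) =
        Polynomial.aeval (MvPolynomial.X i) (componentPoly k 1 2) := by
      rw [RingEquiv.symm_apply_eq]
      exact (stdEval_componentPoly c.1 c.2 i).symm
    change surfaceEval k n (e.symm (componentOn k c.1 c.2 i)) = 0
    rw [h1, surfaceEval_componentPoly]
  have hs : Function.Surjective (Ideal.Quotient.lift _ _ h0) :=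
    Ideal.Quotient.lift_surjective_of_surjective _ _
      (surfaceEval_surjective.comp e.symm.surjective)
  refine le_trans ?_ (ringKrullDim_le_of_surjective _ hs)
  simp

theorem isRegular_germ_sectionComponent [CharZero k] {w : ambient k n}
    (hw : w ∈ (zeroLocus k n).support) (σ : Fin n → Fin 2) (j : Fin 3)
    (h : ∀ i, w ∈ opens k i (σ i) j) :
    RingTheory.Sequence.IsRegular ((ambient k n).presheaf.stalk w)
      (List.ofFn fun i => (ambient k n).presheaf.germ _ w (h i)
        (sectionComponent k i (σ i) j)) := by
  -- For `n = 0` the hypothesis `h` is empty and does not place `w` in the chart of `j`; there the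
  -- empty sequence is regular because the stalk is nonzero.
  rcases n with - | n
  · rw [List.ofFn_zero]
    exact RingTheory.Sequence.IsRegular.nil _ _
  · have hj : w ∈ stdOpen k σ j := mem_stdOpen.mpr ⟨(h 0).2, fun i => (h i).1⟩
    have := isRegular_germ_componentOn hw σ j hj
    simpa only [germ_componentOn] using this

end DimensionTwo

end DiagonalAction

theorem mainTheorem10 (k : Type u) [Field k] [IsAlgClosed k] [CharZero k] (n : ℕ) :
    -- `M` is the intersection of the divisors `s_i = 0`
    DiagonalAction.zeroLocus k n = ⨆ i : Fin n, DiagonalAction.formLocus k i ∧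
    -- `M` is a local complete intersection of codimension `n`
    DiagonalAction.IsLocalCompleteIntersection (DiagonalAction.zeroLocus k n) n ∧
    -- at every point of `M`, in every local frame, the components of `s` form a regular sequence
    (∀ w ∈ (DiagonalAction.zeroLocus k n).support, ∀ (σ : Fin n → Fin 2) (j : Fin 3)
      (hw : ∀ i, w ∈ DiagonalAction.opens k i (σ i) j),
      RingTheory.Sequence.IsRegular ((DiagonalAction.ambient k n).presheaf.stalk w)
        (List.ofFn fun i => (DiagonalAction.ambient k n).presheaf.germ _ w (hw i)
          (DiagonalAction.sectionComponent k i (σ i) j))) ∧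
    -- `M` has dimension two
    topologicalKrullDim (DiagonalAction.zeroLocus k n).subscheme = 2 :=
  ⟨DiagonalAction.zeroLocus_eq, DiagonalAction.isLocalCompleteIntersection_zeroLocus,
    fun _ hw σ j h => DiagonalAction.isRegular_germ_sectionComponent hw σ j h,
    le_antisymm DiagonalAction.topologicalKrullDim_zeroLocus_le
      DiagonalAction.two_le_topologicalKrullDim_zeroLocus⟩
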